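/- Let $(X,d)$ be a complete separable metric space and $m$ a non-negative locally finite Borel (i.e. Radon) measure on $X$. *Definitions.* A test plan is a Borel probability measure $\pi$ on $C([0,1],X)$, concentrated on $AC^2([0,1],X)$, such that $(e_t)_\sharp\pi\le C m$ for all $t\in[0,1]$ and some constant $C$ (where $e_t(\gamma)=\gamma_t$), and $\iint_0^1|\dot\gamma_t|^2\,dt\,d\pi(\gamma)<\infty$. A Borel function $f:X\to\mathbb R$ belongs to $S^2(X)$ if there is a non-negative $G\in L^2(X,m)$ (a weak upper gradient of $f$) with $$\int|f(\gamma_1)-f(\gamma_0)|\,d\pi(\gamma)\le\iint_0^1G(\gamma_t)|\dot\gamma_t|\,dt\,d\pi(\gamma)\qquad\text{for every test plan }\pi;$$ the $m$-a.e. minimal such $G$ is denoted $|Df|$. The space $(X,d,m)$ is infinitesimally Hilbertian if $\||D(f+g)|\|_{L^2}^2+\||D(f-g)|\|_{L^2}^2=2\big(\||Df|\|_{L^2}^2+\||Dg|\|_{L^2}^2\big)$ for all $f,g\in S^2(X)$. Let $\Omega\subseteq X$ be open. $S^2_{loc}(\Omega)$ is the class of Borel functions $f:\Omega\to\mathbb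 R$ such that every $x\in\Omega$ has an open neighbourhood $U\subseteq\Omega$ for which $f\chi\in S^2(X)$ for every Lipschitz function $\chi:X\to\mathbb R$ with support in $U$ ($f\chi$ being extended by $0$). For $f\in S^2_{loc}(\Omega)$, $|Df|$ is the function on $\Omega$, unique up to $m$-a.e. equality, such that $|Df|=|D(f\chi)|$ $m$-a.e. on $\{\chi=1\}$ for every Lipschitz $\chi$ with support in $\Omega$ such that $f\chi\in S^2(X)$. $L^\infty_{loc}(\Omega)$ is the class of functions that are $m$-essentially bounded in a neighbourhood of each point of $\Omega$. For $f,g\in S^2_{loc}(\Omega)$ set $$\nabla f\cdot\nabla g:=\operatorname*{ess\,inf}_{\varepsilon>0}\frac{|D(g+\varepsilon f)|^2-|Dg|^2}{2\varepsilon},$$ the $m$-a.e. greatest measurable function on $\Omega$ lying $m$-a.e. below each of these difference quotients. **Theorem.** Let $(X,d,m)$ be infinitesimally Hilbertian and $\Omega\subseteq X$ open. Then the minimal weak upper gradient $|Df|$ exists for every $f\in S^2(X)$ and for every $f\in S^2_{loc}(\Omega)$, and $\nabla f\cdot\nabla g$ is a well-defined real-valued function ($m$-a.e. on $\Omega$)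 for all $f,g\in S^2_{loc}(\Omega)$. Moreover, all identities and inequalities being understood $m$-a.e. on $\Omega$: 1. (Cauchy–Schwarz) For $f,g\in S^2_{loc}(\Omega)$: $\nabla f\cdot\nabla f=|Df|^2$ and $|\nabla f\cdot\nabla g|\le|Df|\,|Dg|$. 2. (Linearity in $f$) For $f_1,f_2,g\in S^2_{loc}(\Omega)$ and $\alpha,\beta\in\mathbb R$: $\alpha f_1+\beta f_2\in S^2_{loc}(\Omega)$ and $\nabla(\alpha f_1+\beta f_2)\cdot\nabla g=\alpha\nabla f_1\cdot\nabla g+\beta\nabla f_2\cdot\nabla g$. 3. (Chain rule in $f$) For $f,g\in S^2_{loc}(\Omega)$ and $\varphi:\mathbb R\to\mathbb R$ Lipschitz: $\varphi\circ f\in S^2_{loc}(\Omega)$ and $\nabla(\varphi\circ f)\cdot\nabla g=\varphi'\circ f\,\nabla f\cdot\nabla g$, where the right-hand side is $0$ by definition at those $x$ such that $\varphi$ is not differentiable at $f(x)$. 4. (Leibniz rule in $f$) For $f_1,f_2\in S^2_{loc}(\Omega)\cap L^\infty_{loc}(\Omega)$ and $g\in S^2_{loc}(\Omega)$: $f_1f_2\in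 S^2_{loc}(\Omega)$ and $\nabla(f_1f_2)\cdot\nabla g=f_1\nabla f_2\cdot\nabla g+f_2\nabla f_1\cdot\nabla g$. 5. (Symmetry) For $f,g\in S^2_{loc}(\Omega)$: $\nabla f\cdot\nabla g=\nabla g\cdot\nabla f$. In particular $\nabla f\cdot\nabla g$ is also linear in $g$ and satisfies in $g$ the chain and Leibniz rules analogous to 3 and 4. -/

import Mathlib

open MeasureTheory Set Filter Topology
open scoped NNReal ENNReal unitInterval

noncomputable section

namespace SobolevMMS

variable {X : Type*} [MetricSpace X]

/-- The metric speed of a curve `γ : [0,1] → X` at time `t`, as an extended nonnegative number.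
For absolutely continuous curves the upper limit is a limit at almost every `t`. -/
def metricSpeed (γ : C(I, X)) (t : I) : ℝ≥0∞ :=
  limsup (fun s : I => edist (γ s) (γ t) / edist s t) (𝓝[≠] t)

/-- `γ ∈ AC²([0,1], X)`. -/
def IsAC2 (γ : C(I, X)) : Prop :=
  ∃ v : ℝ → ℝ, MemLp v 2 (volume.restrict (Icc (0 : ℝ) 1)) ∧
    ∀ s t : I, s < t → dist (γ t) (γ s) ≤ ∫ r in (s : ℝ)..(t : ℝ), v r

/-- The space of curves `C([0,1], X)` carries its Borel σ-algebra (for the topology of uniform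
convergence). -/
instance curveMeasurableSpace : MeasurableSpace C(I, X) := borel _

instance curveBorelSpace : BorelSpace C(I, X) := ⟨rfl⟩

variable [MeasurableSpace X]

/-- Test plans: probability measures on curves, concentrated on `AC²`, with bounded compression and
finite kinetic energy. -/
structure IsTestPlan (m : Measure X) (π : Measure C(I, X)) : Prop where
  isProbabilityMeasure : IsProbabilityMeasure π
  bounded_compression : ∃ C : ℝ≥0, ∀ t : I, π.map (fun γ : C(I, X) => γ t) ≤ C • m
  ae_isAC2 : ∀ᵐ γ ∂π, IsAC2 γ
  finite_energy : ∫⁻ γ, (∫⁻ t : I, metricSpeed γ t ^ 2) ∂π < ∞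

/-- `G ∈ L²(X, m)`, `G ≥ 0`, is a weak upper gradient of `f`. -/
structure IsWeakUpperGradient (m : Measure X) (f G : X → ℝ) : Prop where
  measurable : Measurable G
  nonneg : ∀ x, 0 ≤ G x
  memLp : MemLp G 2 m
  lintegral_le : ∀ π : Measure C(I, X), IsTestPlan m π →
    ∫⁻ γ, ENNReal.ofReal |f (γ 1) - f (γ 0)| ∂π ≤
      ∫⁻ γ, (∫⁻ t : I, ENNReal.ofReal (G (γ t)) * metricSpeed γ t) ∂π

/-- The Sobolev class `S²(X, d, m)`. -/
def IsSobolev (m : Measure X) (f : X → ℝ) : Prop :=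
  Measurable f ∧ ∃ G : X → ℝ, IsWeakUpperGradient m f G

/-- `G` is a weak upper gradient of `f` which is minimal in the `m`-a.e. sense. -/
def IsMinimalWeakUpperGradient (m : Measure X) (f G : X → ℝ) : Prop :=
  IsWeakUpperGradient m f G ∧ ∀ G' : X → ℝ, IsWeakUpperGradient m f G' → G ≤ᵐ[m] G'

open Classical in
/-- (A representative of) the minimal weak upper gradient `|Df|` of `f ∈ S²(X, d, m)`. -/
def minGrad (m : Measure X) (f : X → ℝ) : X → ℝ :=
  if h : ∃ G : X → ℝ, IsMinimalWeakUpperGradient m f G then h.choose else 0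

/-- `f ↦ ‖|Df|‖²_{L²}` satisfies the parallelogram identity on `S²(X, d, m)`. -/
def InfinitesimallyHilbertian (m : Measure X) : Prop :=
  ∀ f g : X → ℝ, IsSobolev m f → IsSobolev m g →
    (∫ x, minGrad m (f + g) x ^ 2 ∂m) + (∫ x, minGrad m (f - g) x ^ 2 ∂m) =
      2 * ((∫ x, minGrad m f x ^ 2 ∂m) + ∫ x, minGrad m g x ^ 2 ∂m)

/-- The local Sobolev class `S²_loc(Ω)`. A function on the open set `Ω` is given by any extension
`f` to `X`; only its values on `Ω` matter, as `f * χ` vanishes off the support of `χ`.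
The products `f χ` have to be in `S²(X)` for all Lipschitz functions `χ` with support in `Ω` which
are local, i.e. supported in a suitable neighbourhood of a given point of `Ω`: on an unbounded
space of infinite measure not even constants have `f χ ∈ S²(X)` for every Lipschitz `χ`. -/
def IsSobolevLoc (m : Measure X) (Ω : Set X) (f : X → ℝ) : Prop :=
  Measurable (Ω.domRestrict f) ∧
    ∀ x ∈ Ω, ∃ U : Set X, IsOpen U ∧ x ∈ U ∧ U ⊆ Ω ∧
      ∀ χ : X → ℝ, (∃ K : ℝ≥0, LipschitzWith K χ) → tsupport χ ⊆ U →
        IsSobolev m (fun y => f y * χ y)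

/-- If `f χ ∈ S²(X)` for every Lipschitz `χ` with support in `Ω`, then `f ∈ S²_loc(Ω)`. -/
theorem IsSobolevLoc.of_forall {m : Measure X} {Ω : Set X} (hΩ : IsOpen Ω) {f : X → ℝ}
    (hf : Measurable (Ω.domRestrict f))
    (h : ∀ χ : X → ℝ, (∃ K : ℝ≥0, LipschitzWith K χ) → tsupport χ ⊆ Ω →
      IsSobolev m (fun y => f y * χ y)) : IsSobolevLoc m Ω f :=
  ⟨hf, fun _ hx => ⟨Ω, hΩ, hx, Subset.rfl, h⟩⟩

/-- `h` is a minimal weak upper gradient of `f` on `Ω`: `h = |D(f χ)|` a.e. on `{χ = 1}` for every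
Lipschitz `χ` with support in `Ω` such that `f χ ∈ S²(X)`. For `f ∈ S²_loc(Ω)` this determines `h`
almost everywhere on `Ω`. -/
def IsLocGrad (m : Measure X) (Ω : Set X) (f h : X → ℝ) : Prop :=
  Measurable h ∧ (∀ x, 0 ≤ h x) ∧
    ∀ χ : X → ℝ, (∃ K : ℝ≥0, LipschitzWith K χ) → tsupport χ ⊆ Ω →
      IsSobolev m (fun y => f y * χ y) →
        ∀ᵐ x ∂m, χ x = 1 → h x = minGrad m (fun y => f y * χ y) x

open Classical in
/-- (A representative of) the minimal weak upper gradient `|Df|` of `f ∈ S²_loc(Ω)`. -/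
def locGrad (m : Measure X) (Ω : Set X) (f : X → ℝ) : X → ℝ :=
  if h : ∃ G : X → ℝ, IsLocGrad m Ω f G then h.choose else 0

/-- `h` is the essential infimum (the a.e. greatest measurable a.e. lower bound) of the family of
functions `q i`, `i ∈ S`. -/
def IsEssInf {ι : Type*} (μ : Measure X) (S : Set ι) (q : ι → X → ℝ) (h : X → ℝ) : Prop :=
  Measurable h ∧ (∀ i ∈ S, h ≤ᵐ[μ] q i) ∧
    ∀ h' : X → ℝ, Measurable h' → (∀ i ∈ S, h' ≤ᵐ[μ] q i) → h' ≤ᵐ[μ] h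

/-- The difference quotient `(|D(g + ε f)|² - |Dg|²) / (2 ε)`. -/
def gradQuotient (m : Measure X) (Ω : Set X) (f g : X → ℝ) (ε : ℝ) (x : X) : ℝ :=
  (locGrad m Ω (fun y => g y + ε * f y) x ^ 2 - locGrad m Ω g x ^ 2) / (2 * ε)

open Classical in
/-- (A representative of) the object `∇f · ∇g` on `Ω`: the essential infimum over `ε > 0` of the
difference quotients. -/
def gradDot (m : Measure X) (Ω : Set X) (f g : X → ℝ) : X → ℝ :=
  if h : ∃ p : X → ℝ, IsEssInf (m.restrict Ω) (Ioi (0 : ℝ)) (gradQuotient m Ω f g) p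
  then h.choose else 0

/-- `f ∈ L^∞_loc(Ω)`: every point of `Ω` has a neighbourhood in which `f` is essentially
bounded. -/
def IsLinftyLoc (m : Measure X) (Ω : Set X) (f : X → ℝ) : Prop :=
  ∀ x ∈ Ω, ∃ U : Set X, IsOpen U ∧ x ∈ U ∧ U ⊆ Ω ∧ ∃ M : ℝ, ∀ᵐ y ∂m, y ∈ U → |f y| ≤ M

end SobolevMMS

end

set_option linter.unusedSectionVars false

noncomputable section

/-! The calculus takes place along curves. Conditioning and stopping a test plan gives new test
plans, so the integrated inequality defining a weak upper gradient localises: along almost every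
curve, `f ∘ γ` agrees a.e. and at both endpoints with an absolutely continuous `U` such that `|U'| ≤
G(γ) |γ'|` (`IsWeakUpperGradient.exists_rep`, with converse `IsWeakUpperGradient.of_rep`).
One-variable calculus for `U` then yields the minimal gradient, its locality, and the triangle,
chain and Leibniz inequalities for `|Df|`.

The main difficulty is to pass from the integrated parallelogram identity to the pointwise one
(`InfinitesimallyHilbertian.parallelogram`). Localising with a Lipschitz cutoff `h` leaves errors of
size `|f| |Dh|`. They are removed by replacing `f`, `g` with `z(f)`, `z(g)`, where `z` is a zigzag
with slopes `±1` and amplitude at most `δ`: the quantities in the parallelogram identity are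
unchanged, while the errors become `O(δ)`. Letting `δ → 0` shows that the defect integrates to zero
against every `h²`, hence vanishes.

Thus `f ↦ |Df|` is, up to null sets, a Hilbert seminorm on `S²_loc(Ω)`. The Jordan–von Neumann
argument makes its polarisation bilinear, and since `|D(g + εf)|²` is a quadratic polynomial in `ε`,
the essential infimum defining `∇f · ∇g` is this polarisation (`isEssInf_polar`). The chain and
Leibniz equalities come from the corresponding inequalities: subtract a linear combination with
constant coefficients, apply Cauchy–Schwarz, and choose the constants depending on the point. That
choice is legitimate because the estimates hold off one null set for all rational constants and are
continuous in them (`le_of_forall_rat_le`). -/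

namespace SobolevMMS

/-! ### Absolutely continuous functions of one variable -/

/-- Absolute continuity on the unit interval. -/
abbrev ACI (U : ℝ → ℝ) : Prop := AbsolutelyContinuousOnInterval U 0 1

theorem ae_unitInterval_iff {p : ℝ → Prop} :
    (∀ᵐ t : I, p t) ↔ ∀ᵐ t ∂volume.restrict (Icc (0 : ℝ) 1), p t :=
  (ae_restrict_iff_subtype measurableSet_Icc).symm

theorem ae_unitInterval_of_ae {p : ℝ → Prop} (h : ∀ᵐ t : ℝ, p t) : ∀ᵐ t : I, p t :=
  ae_unitInterval_iff.2 (ae_restrict_of_ae h)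

theorem lintegral_unitInterval (F : ℝ → ℝ≥0∞) :
    ∫⁻ t : I, F t = ∫⁻ t in Icc (0 : ℝ) 1, F t :=
  lintegral_subtype_comap measurableSet_Icc F

theorem ae_mem_Ioo : ∀ᵐ t : I, (t : ℝ) ∈ Ioo (0 : ℝ) 1 := by
  refine ae_unitInterval_iff.2 ?_
  rw [Measure.restrict_congr_set Ioo_ae_eq_Icc.symm]
  exact ae_restrict_mem measurableSet_Ioo

theorem ACI.ae_differentiableAt {U : ℝ → ℝ} (hU : ACI U) :
    ∀ᵐ t : I, DifferentiableAt ℝ U t := by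
  have h := ae_unitInterval_of_ae (AbsolutelyContinuousOnInterval.ae_differentiableAt hU)
  filter_upwards [h] with t ht
  exact ht (by rw [uIcc_of_le zero_le_one]; exact t.2)

theorem ACI.continuousOn {U : ℝ → ℝ} (hU : ACI U) : ContinuousOn U (Icc 0 1) := by
  have := AbsolutelyContinuousOnInterval.continuousOn hU
  rwa [uIcc_of_le zero_le_one] at this

theorem ACI.comp_lipschitz {U φ : ℝ → ℝ} {K : ℝ≥0} (hφ : LipschitzWith K φ) (hU : ACI U) :
    ACI (fun t => φ (U t)) := by
  rw [ACI, absolutelyContinuousOnInterval_iff] at *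
  intro ε hε
  obtain ⟨δ, hδ, h⟩ := hU (ε / (K + 1)) (by positivity)
  refine ⟨δ, hδ, fun E hE hs => ?_⟩
  have h1 := h E hE hs
  rw [lt_div_iff₀ (by positivity)] at h1
  refine lt_of_le_of_lt ?_ h1
  rw [Finset.sum_mul]
  refine Finset.sum_le_sum fun i _ => (hφ.dist_le_mul _ _).trans ?_
  nlinarith [dist_nonneg (x := U (E.2 i).1) (y := U (E.2 i).2), K.2]

theorem ACI.eqOn_of_ae {U V : ℝ → ℝ} (hU : ACI U) (hV : ACI V) (h : ∀ᵐ t : I, U t = V t) :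
    EqOn U V (Icc 0 1) := by
  exact Measure.eqOn_Icc_of_ae_eq volume zero_ne_one (ae_unitInterval_iff.1 h) hU.continuousOn
    hV.continuousOn

theorem ae_deriv_eq_of_eqOn {U V : ℝ → ℝ} (h : EqOn U V (Icc 0 1)) :
    ∀ᵐ t : I, deriv U t = deriv V t := by
  filter_upwards [ae_mem_Ioo] with t ht
  refine EventuallyEq.deriv_eq ?_
  filter_upwards [Icc_mem_nhds ht.1 ht.2] with s hs using h hs

/-- A function has zero derivative almost everywhere on the preimage of a null set. -/
theorem ae_deriv_eq_zero_of_mem_null (U : ℝ → ℝ) {N : Set ℝ} (hN : volume N = 0) :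
    ∀ᵐ t : ℝ, U t ∈ N → DifferentiableAt ℝ U t → deriv U t = 0 := by
  -- A point of `U ⁻¹' N` with nonzero derivative lies in some `A n`. On short pieces of `A n` the
  -- map `U` is antilipschitz, so the null set containing the image forces the piece itself to be
  -- null.
  let A : ℕ → Set ℝ := fun n => {t | U t ∈ N ∧
    ∀ s, |s - t| < 1 / (n + 1 : ℝ) → |s - t| ≤ (n + 1 : ℝ) * |U s - U t|}
  have hA : ∀ n, volume (A n) = 0 := by
    intro n
    refine measure_null_of_locally_null _ fun x _ => ?_
    -- Half the scale of `A n`, so that any two points of the ball are close enough for the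
    -- condition in `A n`.
    have hr : (0 : ℝ) < 1 / (2 * (n + 1)) := by positivity
    refine ⟨A n ∩ Metric.ball x (1 / (2 * (n + 1))),
      inter_mem_nhdsWithin _ (Metric.ball_mem_nhds _ hr), ?_⟩
    set S := A n ∩ Metric.ball x (1 / (2 * (n + 1)))
    have hanti : AntilipschitzWith ((n : ℝ≥0) + 1) (fun t : S => U t) := by
      refine AntilipschitzWith.of_le_mul_dist fun s t => ?_
      have h1 := s.2.2
      have h2 := t.2.2
      have h3 : |(s : ℝ) - t| < 1 / (n + 1 : ℝ) := by
        rw [← Real.dist_eq]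
        refine (dist_triangle_right _ _ x).trans_lt ((add_lt_add h1 h2).trans_le (le_of_eq ?_))
        field_simp; ring
      have := t.2.1.2 s h3
      simpa [Subtype.dist_eq, Real.dist_eq] using this
    have h1 := hanti.le_hausdorffMeasure_image (d := 1) zero_le_one univ
    have h2 : μH[1] ((fun t : S => U t) '' univ) = 0 := by
      rw [hausdorffMeasure_real]
      refine measure_mono_null ?_ hN
      rintro _ ⟨t, -, rfl⟩
      exact t.2.1.1
    rw [h2, mul_zero, ← (isometry_subtype_coe (s := S)).hausdorffMeasure_image (Or.inl zero_le_one),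
      image_univ, Subtype.range_coe, hausdorffMeasure_real] at h1
    exact le_antisymm h1 bot_le
  have hA' : ∀ᵐ t : ℝ, ∀ n, t ∉ A n := ae_all_iff.2 fun n => measure_eq_zero_iff_ae_notMem.1 (hA n)
  filter_upwards [hA'] with t ht hUt hd
  by_contra hne
  have hlim := hd.hasDerivAt.isLittleO
  have hpos : 0 < |deriv U t| := abs_pos.2 hne
  have h1 := hlim.def (half_pos hpos)
  obtain ⟨δ, hδ, hb⟩ := Metric.eventually_nhds_iff.1 h1
  obtain ⟨n, hn⟩ := exists_nat_gt (max (1 / δ) (2 / |deriv U t|))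
  refine ht n ⟨hUt, fun s hs => ?_⟩
  have hn0 : (0 : ℝ) < n + 1 := by positivity
  have hn1 : 1 / (n + 1 : ℝ) ≤ δ := by
    rw [div_le_comm₀ hn0 hδ]
    linarith [(le_max_left _ _).trans_lt hn]
  have hn2 : 2 ≤ (n + 1 : ℝ) * |deriv U t| := by
    have := (le_max_right (1 / δ) (2 / |deriv U t|)).trans_lt hn
    rw [div_lt_iff₀ hpos] at this
    nlinarith
  have h2 := hb (y := s) (by rw [Real.dist_eq]; linarith)
  simp only [Real.norm_eq_abs, smul_eq_mul] at h2
  have h3 : |s - t| * |deriv U t| ≤ |U s - U t| + |U s - U t - (s - t) * deriv U t| := by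
    rw [← abs_mul, ← abs_neg (U s - U t - _)]
    refine le_trans (le_of_eq ?_) (abs_add_le _ _)
    congr 1; ring
  nlinarith [abs_nonneg (s - t), abs_nonneg (U s - U t)]

theorem ACI.ae_deriv_eq_zero {U : ℝ → ℝ} (hU : ACI U) {N : Set ℝ} (hN : volume N = 0) :
    ∀ᵐ t : I, U t ∈ N → deriv U t = 0 := by
  filter_upwards [hU.ae_differentiableAt, ae_unitInterval_of_ae (ae_deriv_eq_zero_of_mem_null U hN)]
    with t h1 h2 h3 using h2 h3 h1

/-- The points where `φ` is not differentiable form a null set, so `U' = 0` at almost every time at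
which `U` takes such a value. There `φ ∘ U` also has derivative zero, and the default value of
`deriv φ` plays no role. -/
theorem ACI.ae_deriv_comp {U φ : ℝ → ℝ} {K : ℝ≥0} (hφ : LipschitzWith K φ) (hU : ACI U) :
    ∀ᵐ t : I, deriv (fun t => φ (U t)) t = deriv φ (U t) * deriv U t := by
  have hN : volume {x | ¬ DifferentiableAt ℝ φ x} = 0 := hφ.ae_differentiableAt_real
  filter_upwards [hU.ae_differentiableAt, hU.ae_deriv_eq_zero hN] with t h1 h2
  by_cases hd : DifferentiableAt ℝ φ (U t)
  · exact deriv_comp (t : ℝ) hd h1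
  · have h3 := h2 hd
    rw [h3, mul_zero]
    have h4 := h1.hasDerivAt
    rw [h3, hasDerivAt_iff_isLittleO] at h4
    refine HasDerivAt.deriv ((hasDerivAt_iff_isLittleO).2 ?_)
    simp only [smul_zero, sub_zero] at h4 ⊢
    refine Asymptotics.IsBigO.trans_isLittleO ?_ h4
    refine Asymptotics.IsBigO.of_bound K (Eventually.of_forall fun s => ?_)
    simpa [Real.dist_eq] using hφ.dist_le_mul (U s) (U t)

theorem ACI.ae_deriv_mul {U V : ℝ → ℝ} (hU : ACI U) (hV : ACI V) :
    ∀ᵐ t : I, deriv (fun t => U t * V t) t = deriv U t * V t + U t * deriv V t := by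
  filter_upwards [hU.ae_differentiableAt, hV.ae_differentiableAt] with t h1 h2
  exact deriv_fun_mul h1 h2

theorem ACI.abs_sub_le {U : ℝ → ℝ} (hU : ACI U) :
    ENNReal.ofReal |U 1 - U 0| ≤ ∫⁻ t : I, ENNReal.ofReal |deriv U t| := by
  rw [← AbsolutelyContinuousOnInterval.integral_deriv_eq_sub hU,
    lintegral_unitInterval (fun t => ENNReal.ofReal |deriv U t|),
    intervalIntegral.integral_of_le zero_le_one, integral_Icc_eq_integral_Ioc.symm]
  simp only [← Real.norm_eq_abs, ofReal_norm]
  exact enorm_integral_le_lintegral_enorm _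

/-- A function on a subset of the unit interval whose increments are controlled by the integral of
an integrable function has an absolutely continuous extension. -/
theorem exists_ACI_extension {T : Set ℝ} (hT : T ⊆ Icc 0 1) {u g : ℝ → ℝ}
    (hg : IntervalIntegrable g volume 0 1) (hg0 : ∀ t, 0 ≤ g t)
    (hu : ∀ s ∈ T, ∀ t ∈ T, s ≤ t → |u t - u s| ≤ ∫ r in s..t, g r) :
    ∃ U : ℝ → ℝ, ACI U ∧ EqOn U u T ∧ ∀ᵐ t : I, |deriv U t| ≤ g t := by
  set Φ : ℝ → ℝ := fun t => ∫ r in (0 : ℝ)..t, g r with hΦ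
  have hΦAC : ACI Φ := hg.absolutelyContinuousOnInterval_intervalIntegral left_mem_uIcc
  have hint : ∀ t ∈ Icc (0 : ℝ) 1, IntervalIntegrable g volume 0 t := fun t ht =>
    hg.mono_set (by rw [uIcc_of_le ht.1, uIcc_of_le zero_le_one]; exact Icc_subset_Icc_right ht.2)
  have hsub : ∀ s ∈ T, ∀ t ∈ T, |u t - u s| ≤ |Φ t - Φ s| := by
    have key : ∀ s ∈ T, ∀ t ∈ T, s ≤ t → |u t - u s| ≤ |Φ t - Φ s| := by
      intro s hs t ht hst
      rw [hΦ, intervalIntegral.integral_interval_sub_left (hint t (hT ht)) (hint s (hT hs))]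
      exact (hu s hs t ht hst).trans (le_abs_self _)
    intro s hs t ht
    rcases le_total s t with h | h
    · exact key s hs t ht h
    · rw [abs_sub_comm, abs_sub_comm (Φ t)]; exact key t ht s hs h
  -- Increments of `u` on `T` are dominated by those of the primitive `Φ`, so there `u` is a
  -- 1-Lipschitz function of `Φ`. Extending that function to a 1-Lipschitz `L` on the line gives `L
  -- ∘ Φ`, whose derivative is at most `Φ' = g`.
  have hinv : ∀ t ∈ T, Function.invFunOn Φ T (Φ t) ∈ T ∧ Φ (Function.invFunOn Φ T (Φ t)) = Φ t :=
    fun t ht => ⟨Function.invFunOn_mem ⟨t, ht, rfl⟩, Function.invFunOn_eq ⟨t, ht, rfl⟩⟩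
  have hlip : LipschitzOnWith 1 (fun y => u (Function.invFunOn Φ T y)) (Φ '' T) := by
    refine LipschitzOnWith.of_dist_le_mul ?_
    rintro _ ⟨s, hs, rfl⟩ _ ⟨t, ht, rfl⟩
    have h1 := hinv s hs
    have h2 := hinv t ht
    have := hsub _ h2.1 _ h1.1
    rw [h1.2, h2.2] at this
    simpa [Real.dist_eq] using this
  obtain ⟨L, hL, hLe⟩ := hlip.extend_real
  refine ⟨fun t => L (Φ t), hΦAC.comp_lipschitz hL, fun t ht => ?_, ?_⟩
  · have h1 := hinv t ht
    have h2 := hsub _ h1.1 _ ht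
    rw [h1.2, sub_self, abs_zero] at h2
    have h3 := hLe ⟨t, ht, rfl⟩
    simp only at h3 ⊢
    rw [← h3]
    linarith [abs_nonpos_iff.1 h2]
  · filter_upwards [hΦAC.ae_deriv_comp hL, ae_unitInterval_of_ae hg.ae_hasDerivAt_integral]
      with t h1 h2
    have h3 := (h2 (by rw [uIcc_of_le zero_le_one]; exact t.2) 0 left_mem_uIcc).deriv
    have h4 := norm_deriv_le_of_lipschitz hL (x₀ := Φ t)
    rw [h1, hΦ, h3, abs_mul, abs_of_nonneg (hg0 _)]
    simp only [Real.norm_eq_abs, NNReal.coe_one] at h4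
    nlinarith [hg0 t]

/-! ### Passing between the unit interval and the real line -/

section RealCurve

theorem measurable_projIcc_unitInterval : Measurable (projIcc (0 : ℝ) 1 zero_le_one) :=
  continuous_projIcc.measurable

/-- The extension to the line of the real part of a function on the unit interval. -/
def toLine (F : I → ℝ≥0∞) (r : ℝ) : ℝ := (F (projIcc 0 1 zero_le_one r)).toReal

theorem toLine_nonneg (F : I → ℝ≥0∞) (r : ℝ) : 0 ≤ toLine F r := ENNReal.toReal_nonneg

theorem toLine_coe (F : I → ℝ≥0∞) (r : I) : toLine F r = (F r).toReal := by
  simp [toLine]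

theorem setLIntegral_Icc_unitInterval (F : I → ℝ≥0∞) (s t : I) :
    ∫⁻ r in Icc s t, F r = ∫⁻ r in Icc (s : ℝ) t, F (projIcc 0 1 zero_le_one r) := by
  rw [← lintegral_indicator measurableSet_Icc]
  have h1 : (fun r : I => (Icc s t).indicator F r) = fun r : I =>
      (Icc (s : ℝ) t).indicator (fun r => F (projIcc 0 1 zero_le_one r)) r := by
    ext r
    by_cases h : r ∈ Icc s t
    · rw [indicator_of_mem h, indicator_of_mem (show (r : ℝ) ∈ Icc (s : ℝ) t from h)]
      simp
    · rw [indicator_of_notMem h, indicator_of_notMem (show (r : ℝ) ∉ Icc (s : ℝ) t from h)]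
  rw [h1, lintegral_unitInterval, setLIntegral_indicator measurableSet_Icc,
    inter_eq_left.2 (Icc_subset_Icc s.2.1 t.2.2)]

theorem measurable_toLine {F : I → ℝ≥0∞} (hF : Measurable F) : Measurable (toLine F) :=
  (hF.comp measurable_projIcc_unitInterval).ennreal_toReal

theorem lintegral_ofReal_toLine {F : I → ℝ≥0∞} (hF : Measurable F) (hfin : ∫⁻ r, F r < ∞)
    (s t : I) : ∫⁻ r in Icc (s : ℝ) t, ENNReal.ofReal (toLine F r) = ∫⁻ r in Icc s t, F r := by
  rw [setLIntegral_Icc_unitInterval]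
  have h1 : ∀ᵐ r : I, F r < ∞ := ae_lt_top hF hfin.ne
  have h2 : ∀ᵐ r ∂volume.restrict (Icc (0 : ℝ) 1), F (projIcc 0 1 zero_le_one r) < ∞ := by
    refine ae_unitInterval_iff.1 ?_
    simpa using h1
  refine lintegral_congr_ae ?_
  filter_upwards [ae_restrict_of_ae_restrict_of_subset (Icc_subset_Icc s.2.1 t.2.2) h2] with r hr
  exact ENNReal.ofReal_toReal hr.ne

theorem intervalIntegrable_toLine {F : I → ℝ≥0∞} (hF : Measurable F) (hfin : ∫⁻ r, F r < ∞) :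
    IntervalIntegrable (toLine F) volume 0 1 := by
  rw [intervalIntegrable_iff_integrableOn_Icc_of_le zero_le_one]
  refine ⟨(measurable_toLine hF).aestronglyMeasurable, ?_⟩
  rw [hasFiniteIntegral_iff_ofReal (Eventually.of_forall (toLine_nonneg F))]
  have := lintegral_ofReal_toLine hF hfin 0 1
  simp only [Icc.coe_zero, Icc.coe_one] at this
  rw [this]
  exact (setLIntegral_le_lintegral _ _).trans_lt hfin

theorem ofReal_integral_toLine {F : I → ℝ≥0∞} (hF : Measurable F) (hfin : ∫⁻ r, F r < ∞)
    {s t : I} (hst : s ≤ t) :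
    ENNReal.ofReal (∫ r in (s : ℝ)..t, toLine F r) = ∫⁻ r in Icc s t, F r := by
  have hst' : (s : ℝ) ≤ t := hst
  rw [← lintegral_ofReal_toLine hF hfin, intervalIntegral.integral_of_le hst',
    ← integral_Icc_eq_integral_Ioc, ofReal_integral_eq_lintegral_ofReal _
      (Eventually.of_forall (toLine_nonneg F))]
  have := intervalIntegrable_toLine hF hfin
  rw [intervalIntegrable_iff_integrableOn_Icc_of_le zero_le_one] at this
  exact this.mono_set (Icc_subset_Icc s.2.1 t.2.2)

theorem le_of_forall_mem_dense {D : Set I} (hD : Dense D) {s t : I} (hst : s < t)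
    {g : I → ℝ≥0∞} (hg : Continuous g) {C : ℝ≥0∞} (h : ∀ q ∈ D, q ∈ Ioo s t → g q ≤ C) :
    g s ≤ C ∧ g t ≤ C := by
  have h1 : Icc s t ⊆ {q | g q ≤ C} := by
    rw [← closure_Ioo hst.ne]
    refine (closure_minimal (hD.open_subset_closure_inter isOpen_Ioo) isClosed_closure).trans ?_
    exact closure_minimal (fun q hq => h q hq.2 hq.1) (isClosed_le hg continuous_const)
  exact ⟨h1 (left_mem_Icc.2 hst.le), h1 (right_mem_Icc.2 hst.le)⟩

end RealCurve

/-! ### Metric speed: measurability and length estimates -/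

section Speed

variable {X : Type*} [MetricSpace X]

theorem metricSpeed_eq (γ : C(I, X)) (t : I) :
    metricSpeed γ t = ⨅ n : ℕ, ⨆ s : I, ⨆ _ : s ∈ Metric.ball t (1 / (n + 1)) ∩ {t}ᶜ,
      edist (γ s) (γ t) / edist s t := by
  rw [metricSpeed, (nhdsWithin_hasBasis Metric.nhds_basis_ball_inv_nat_succ {t}ᶜ).limsup_eq_iInf_iSup]
  simp

/-- With radii `1 / (n + 1)` the upper limit is a countable infimum. Each supremum over a punctured
ball is lower semicontinuous in `(γ, t)`: its superlevel sets are unions over `s` of open sets, so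
the uncountable range of `s` is harmless. -/
theorem measurable_metricSpeed [SecondCountableTopology X] :
    Measurable (fun p : C(I, X) × I => metricSpeed p.1 p.2) := by
  simp only [metricSpeed_eq]
  refine Measurable.iInf fun n => measurable_of_Ioi fun a => IsOpen.measurableSet ?_
  have : (fun p : C(I, X) × I => ⨆ s : I, ⨆ _ : s ∈ Metric.ball p.2 (1 / ((n : ℝ) + 1)) ∩ {p.2}ᶜ,
      edist (p.1 s) (p.1 p.2) / edist s p.2) ⁻¹' Ioi a = ⋃ s : I, {p : C(I, X) × I |
        (dist s p.2 < 1 / ((n : ℝ) + 1) ∧ s ≠ p.2) ∧ a < edist (p.1 s) (p.1 p.2) / edist s p.2} := by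
    ext p
    simp [lt_iSup_iff]
  rw [this]
  refine isOpen_iUnion fun s => ?_
  by_cases ha : a = ∞
  · simp [ha]
  have h2 : {p : C(I, X) × I | (dist s p.2 < 1 / ((n : ℝ) + 1) ∧ s ≠ p.2) ∧
      a < edist (p.1 s) (p.1 p.2) / edist s p.2} = {p : C(I, X) × I |
      (dist s p.2 < 1 / ((n : ℝ) + 1) ∧ s ≠ p.2) ∧ a * edist s p.2 < edist (p.1 s) (p.1 p.2)} := by
    ext p
    refine and_congr_right fun h => ?_
    rw [ENNReal.lt_div_iff_mul_lt (Or.inl (by simpa using h.2)) (Or.inl (edist_ne_top _ _))]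
  rw [h2]
  have h3 : IsOpen {p : C(I, X) × I | dist s p.2 < 1 / ((n : ℝ) + 1)} :=
    isOpen_lt (by fun_prop) continuous_const
  have h4 : IsOpen {p : C(I, X) × I | s ≠ p.2} := isOpen_ne_fun continuous_const continuous_snd
  have h5 : IsOpen {p : C(I, X) × I | a * edist s p.2 < edist (p.1 s) (p.1 p.2)} :=
    isOpen_lt ((ENNReal.continuous_const_mul ha).comp (continuous_const.edist continuous_snd))
      (by fun_prop)
  exact (h3.inter h4).inter h5

theorem measurable_metricSpeed_curve [SecondCountableTopology X] (γ : C(I, X)) :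
    Measurable (metricSpeed γ) := by
  have h : Measurable (fun t : I => (γ, t)) := measurable_prodMk_left
  have h2 := (measurable_metricSpeed (X := X)).comp h
  exact h2

theorem ofReal_abs_deriv_le {K : ℝ≥0} {h : X → ℝ} (hh : LipschitzWith K h) {γ : C(I, X)}
    {U : ℝ → ℝ} (hU : ∀ t : I, U t = h (γ t)) {t : I} (hd : DifferentiableAt ℝ U t) :
    ENNReal.ofReal |deriv U t| ≤ K * metricSpeed γ t := by
  have h1 : Tendsto (fun s : I => (s : ℝ)) (𝓝[≠] t) (𝓝[≠] (t : ℝ)) := by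
    refine tendsto_nhdsWithin_of_tendsto_nhds_of_eventually_within _ ?_ ?_
    · exact (continuous_subtype_val.tendsto t).mono_left nhdsWithin_le_nhds
    · filter_upwards [self_mem_nhdsWithin] with s hs
      simpa [Subtype.ext_iff] using hs
  have h2 := hd.hasDerivAt.tendsto_slope.comp h1
  have h3 : Tendsto (fun s : I => ENNReal.ofReal |slope U t s|) (𝓝[≠] t)
      (𝓝 (ENNReal.ofReal |deriv U t|)) := ENNReal.tendsto_ofReal h2.abs
  rw [← h3.limsup_eq, metricSpeed, ← ENNReal.limsup_const_mul_of_ne_top ENNReal.coe_ne_top]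
  refine limsup_le_limsup ?_
  filter_upwards [self_mem_nhdsWithin] with s hs
  have hs' : (s : ℝ) ≠ t := by simpa [Subtype.ext_iff] using hs
  have h4 := hh.edist_le_mul (γ s) (γ t)
  rw [← hU, ← hU, edist_dist, Real.dist_eq] at h4
  rw [slope_def_field, abs_div, ENNReal.ofReal_div_of_pos (abs_pos.2 (sub_ne_zero.2 hs')),
    ← mul_div_assoc, Subtype.edist_eq, edist_dist (s : ℝ), Real.dist_eq]
  gcongr

theorem IsAC2.intervalIntegrable {v : ℝ → ℝ}
    (hv : MemLp v 2 (volume.restrict (Icc (0 : ℝ) 1))) : IntervalIntegrable v volume 0 1 := by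
  rw [intervalIntegrable_iff_integrableOn_Icc_of_le zero_le_one]
  exact hv.integrable one_le_two

/-- Lipschitz functions are absolutely continuous along `AC²` curves. -/
theorem IsAC2.exists_ACI {γ : C(I, X)} (hγ : IsAC2 γ) {K : ℝ≥0} {h : X → ℝ}
    (hh : LipschitzWith K h) :
    ∃ U : ℝ → ℝ, ACI U ∧ (∀ t : I, U t = h (γ t)) ∧
      ∀ᵐ t : I, ENNReal.ofReal |deriv U t| ≤ K * metricSpeed γ t := by
  obtain ⟨v, hv, hvd⟩ := hγ
  have hvi := IsAC2.intervalIntegrable hv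
  obtain ⟨U, hU, hUe, -⟩ := exists_ACI_extension (T := Icc 0 1) Subset.rfl
    (u := fun t => h (γ (projIcc 0 1 zero_le_one t))) (g := fun t => K * |v t|)
    (hvi.abs.const_mul K) (fun t => by positivity) (by
      intro s hs t ht hst
      rcases hst.eq_or_lt with rfl | hlt
      · simp
      have h1 := hvd ⟨s, hs⟩ ⟨t, ht⟩ hlt
      have h2 := hh.dist_le_mul (γ ⟨t, ht⟩) (γ ⟨s, hs⟩)
      rw [projIcc_of_mem _ hs, projIcc_of_mem _ ht, ← Real.dist_eq,
        intervalIntegral.integral_const_mul]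
      refine h2.trans (mul_le_mul_of_nonneg_left (h1.trans ?_) K.2)
      have h3 : IntervalIntegrable v volume s t := hvi.mono_set (by
        rw [uIcc_of_le hst, uIcc_of_le zero_le_one]; exact Icc_subset_Icc hs.1 ht.2)
      exact intervalIntegral.integral_mono hst h3 h3.abs fun r => le_abs_self _)
  have hUe' : ∀ t : I, U t = h (γ t) := fun t => by simpa using hUe t.2
  refine ⟨U, hU, hUe', ?_⟩
  filter_upwards [hU.ae_differentiableAt] with t ht
  exact ofReal_abs_deriv_le hh hUe' ht

/-- Apply the fundamental theorem of calculus to the 1-Lipschitz function `dist · (γ s)` along the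
curve: it vanishes at time `s` and its derivative is bounded by the metric speed. -/
theorem IsAC2.edist_le [SecondCountableTopology X] {γ : C(I, X)} (hγ : IsAC2 γ) {s t : I}
    (hst : s ≤ t) : edist (γ s) (γ t) ≤ ∫⁻ r in Icc s t, metricSpeed γ r := by
  obtain ⟨U, hU, hUe, hUd⟩ := hγ.exists_ACI (LipschitzWith.dist_right (γ s))
  have hst' : (s : ℝ) ≤ t := hst
  have hsub : Icc (s : ℝ) t ⊆ Icc 0 1 := Icc_subset_Icc s.2.1 t.2.2
  have hU' : AbsolutelyContinuousOnInterval U s t := AbsolutelyContinuousOnInterval.mono hU (by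
    rw [uIcc_of_le hst', uIcc_of_le zero_le_one]; exact hsub)
  have h1 := AbsolutelyContinuousOnInterval.integral_deriv_eq_sub hU'
  rw [hUe, hUe, dist_self, sub_zero] at h1
  rw [edist_dist, setLIntegral_Icc_unitInterval, ← abs_of_nonneg (dist_nonneg), ← h1,
    intervalIntegral.integral_of_le hst', ← integral_Icc_eq_integral_Ioc,
    ← Real.norm_eq_abs, ofReal_norm]
  refine (enorm_integral_le_lintegral_enorm _).trans (lintegral_mono_ae ?_)
  have h2 : ∀ᵐ r ∂volume.restrict (Icc (0 : ℝ) 1),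
      ENNReal.ofReal |deriv U r| ≤ metricSpeed γ (projIcc 0 1 zero_le_one r) := by
    refine ae_unitInterval_iff.1 ?_
    simpa using hUd
  filter_upwards [ae_restrict_of_ae_restrict_of_subset hsub h2] with r hr
  rwa [← Real.norm_eq_abs, ofReal_norm] at hr

/-- A sufficient condition for `AC²`, measurable in the curve. -/
def speedBounded (D : Set I) : Set C(I, X) :=
  {γ | ∫⁻ t : I, metricSpeed γ t ^ 2 < ∞ ∧ ∀ s ∈ D, ∀ t ∈ D, s ≤ t →
    edist (γ s) (γ t) ≤ ∫⁻ r in Icc s t, metricSpeed γ r}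

theorem lintegral_speed_lt_top [SecondCountableTopology X] {γ : C(I, X)}
    (h : ∫⁻ t : I, metricSpeed γ t ^ 2 < ∞) : ∫⁻ t : I, metricSpeed γ t < ∞ := by
  refine (lintegral_mono (g := fun t => 1 + metricSpeed γ t ^ 2) fun t => ?_).trans_lt ?_
  · rcases le_total (metricSpeed γ t) 1 with h1 | h1
    · exact h1.trans le_self_add
    · exact (le_self_pow₀ h1 two_ne_zero).trans le_add_self
  · rw [lintegral_add_left measurable_const]
    simpa using h

/-- The metric speed itself serves as `v`; continuity of the curve carries the estimate from `D` to
all times. For countable `D` the condition is measurable in `γ`, so it can be checked for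
pushforwards of plans. -/
theorem isAC2_of_speedBounded [SecondCountableTopology X] {D : Set I} (hD : Dense D)
    {γ : C(I, X)} (hγ : γ ∈ speedBounded D) : IsAC2 γ := by
  obtain ⟨h1, h2⟩ := hγ
  have hm := measurable_metricSpeed_curve γ
  have hfin := lintegral_speed_lt_top h1
  refine ⟨toLine (metricSpeed γ), ?_, fun s t hst => ?_⟩
  · refine (memLp_two_iff_integrable_sq (measurable_toLine hm).aestronglyMeasurable).2
      ⟨((measurable_toLine hm).pow_const 2).aestronglyMeasurable, ?_⟩
    rw [hasFiniteIntegral_iff_ofReal (Eventually.of_forall fun r => sq_nonneg _)]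
    rw [← lintegral_unitInterval (fun r => ENNReal.ofReal (toLine (metricSpeed γ) r ^ 2))]
    refine (lintegral_mono fun t => ?_).trans_lt h1
    rw [toLine_coe, ENNReal.ofReal_pow ENNReal.toReal_nonneg]
    gcongr
    exact ENNReal.ofReal_toReal_le
  · have h3 : edist (γ s) (γ t) ≤ ∫⁻ r in Icc s t, metricSpeed γ r := by
      refine (le_of_forall_mem_dense hD hst (g := fun q => edist (γ q) (γ t)) (by fun_prop)
        fun q hq hqm => ?_).1
      refine (le_of_forall_mem_dense hD hqm.2 (g := fun q' => edist (γ q) (γ q')) (by fun_prop)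
        fun q' hq' hqm' => ?_).2
      refine (h2 q hq q' hq' hqm'.1.le).trans (lintegral_mono_set ?_)
      exact Icc_subset_Icc hqm.1.le hqm'.2.le
    rw [← ofReal_integral_toLine hm hfin hst.le, edist_dist, dist_comm] at h3
    refine (ENNReal.ofReal_le_ofReal_iff ?_).1 h3
    exact intervalIntegral.integral_nonneg (show (s : ℝ) ≤ t from hst.le)
      fun r _ => toLine_nonneg _ _

theorem measurableSet_speedBounded [SecondCountableTopology X] {D : Set I} (hD : D.Countable) :
    MeasurableSet (speedBounded D : Set C(I, X)) := by
  have hm : Measurable fun p : C(I, X) × I => metricSpeed p.1 p.2 := measurable_metricSpeed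
  refine MeasurableSet.inter ?_ ?_
  · exact measurableSet_lt ((hm.pow_const 2).lintegral_prod_right') measurable_const
  · have : {γ : C(I, X) | ∀ s ∈ D, ∀ t ∈ D, s ≤ t →
        edist (γ s) (γ t) ≤ ∫⁻ r in Icc s t, metricSpeed γ r} = ⋂ s ∈ D, ⋂ t ∈ D, ⋂ _ : s ≤ t,
        {γ : C(I, X) | edist (γ s) (γ t) ≤ ∫⁻ r in Icc s t, metricSpeed γ r} := by
      ext γ; simp only [mem_ofPred_eq, mem_iInter]
    change MeasurableSet {γ : C(I, X) | ∀ s ∈ D, ∀ t ∈ D, s ≤ t →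
        edist (γ s) (γ t) ≤ ∫⁻ r in Icc s t, metricSpeed γ r}
    rw [this]
    refine MeasurableSet.biInter hD fun s _ => MeasurableSet.biInter hD fun t _ =>
      MeasurableSet.iInter fun _ => measurableSet_le ?_ hm.lintegral_prod_right'
    exact Continuous.measurable (by fun_prop)

end Speed

/-! ### Stopping and conditioning test plans -/

section Stop

/-- The retraction of the unit interval onto `[a, b]`. -/
def clamp (a b : I) : C(I, I) := ⟨fun r => max a (min b r), by fun_prop⟩

theorem clamp_apply (a b r : I) : clamp a b r = max a (min b r) := rfl

theorem clamp_of_mem {a b r : I} (h : r ∈ Icc a b) : clamp a b r = r := by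
  rw [clamp_apply, min_eq_right h.2, max_eq_right h.1]

theorem clamp_zero {a b : I} (_h : a ≤ b) : clamp a b 0 = a := by
  have h0 : (0 : I) ≤ a := unitInterval.nonneg'
  have h1 : (0 : I) ≤ b := unitInterval.nonneg'
  rw [clamp_apply, min_eq_right h1, max_eq_left h0]

theorem clamp_one {a b : I} (h : a ≤ b) : clamp a b 1 = b := by
  have h1 : b ≤ (1 : I) := unitInterval.le_one'
  rw [clamp_apply, min_eq_left h1, max_eq_right h]

variable {X : Type*} [MetricSpace X]

theorem metricSpeed_congr {γ γ' : C(I, X)} {t : I} (h : (fun s => γ s) =ᶠ[𝓝 t] fun s => γ' s) :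
    metricSpeed γ t = metricSpeed γ' t := by
  refine limsup_congr ?_
  have h0 : γ t = γ' t := h.self_of_nhds
  filter_upwards [h.filter_mono nhdsWithin_le_nhds] with s hs
  rw [hs, h0]

theorem metricSpeed_const (x : X) (t : I) : metricSpeed (ContinuousMap.const I x) t = 0 := by
  simp only [metricSpeed, ContinuousMap.const_apply, edist_self, ENNReal.zero_div]
  exact limsup_const_bot

/-- Off the two times `a` and `b`, the stopped curve coincides locally with `γ` or with a constant
curve. -/
theorem metricSpeed_comp_clamp {a b : I} (hab : a ≤ b) (γ : C(I, X)) :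
    ∀ᵐ r : I, metricSpeed (γ.comp (clamp a b)) r = (Icc a b).indicator (metricSpeed γ) r := by
  have hne : ∀ᵐ r : I, r ∉ ({a, b} : Set I) :=
    measure_eq_zero_iff_ae_notMem.1 ((Set.toFinite _).measure_zero _)
  filter_upwards [hne] with r hr
  simp only [mem_insert_iff, mem_singleton_iff, not_or] at hr
  rcases lt_or_gt_of_ne hr.1 with h1 | h1
  · rw [indicator_of_notMem (fun h => h1.not_ge h.1), ← metricSpeed_const (γ a) r]
    refine metricSpeed_congr ?_
    filter_upwards [Iio_mem_nhds h1] with s hs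
    have hs' : min b s ≤ a := (min_le_right _ _).trans (le_of_lt hs)
    simp [clamp_apply, max_eq_left hs']
  rcases lt_or_gt_of_ne hr.2 with h2 | h2
  · rw [indicator_of_mem (show r ∈ Icc a b from ⟨le_of_lt h1, le_of_lt h2⟩)]
    refine metricSpeed_congr ?_
    filter_upwards [Ioo_mem_nhds h1 h2] with s hs
    rw [ContinuousMap.comp_apply, clamp_of_mem (Ioo_subset_Icc_self hs)]
  · rw [indicator_of_notMem (fun h => h2.not_ge h.2), ← metricSpeed_const (γ b) r]
    refine metricSpeed_congr ?_
    filter_upwards [Ioi_mem_nhds h2] with s hs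
    simp [clamp_apply, min_eq_left (le_of_lt (show b < s from hs)), max_eq_right hab]

theorem clamp_mono (a b : I) : Monotone (clamp a b) := fun _ _ h =>
  max_le_max le_rfl (min_le_min le_rfl h)

theorem continuous_comp_clamp (a b : I) :
    Continuous (fun γ : C(I, X) => γ.comp (clamp a b)) :=
  ContinuousMap.continuous_precomp _

theorem measurable_comp_clamp (a b : I) :
    Measurable (fun γ : C(I, X) => γ.comp (clamp a b)) :=
  (continuous_comp_clamp a b).measurable

theorem lintegral_speed_sq_comp_clamp_le {a b : I} (hab : a ≤ b) (γ : C(I, X)) :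
    ∫⁻ t, metricSpeed (γ.comp (clamp a b)) t ^ 2 ≤ ∫⁻ t, metricSpeed γ t ^ 2 := by
  refine lintegral_mono_ae ?_
  filter_upwards [metricSpeed_comp_clamp hab γ] with t ht
  rw [ht]
  gcongr
  exact indicator_le_self _ _ t

theorem comp_clamp_mem_speedBounded [SecondCountableTopology X] {a b : I} (hab : a ≤ b)
    (D : Set I) {γ : C(I, X)} (hγ : IsAC2 γ) (hs : ∫⁻ t : I, metricSpeed γ t ^ 2 < ∞) :
    γ.comp (clamp a b) ∈ speedBounded D := by
  refine ⟨(lintegral_speed_sq_comp_clamp_le hab γ).trans_lt hs, fun s _ t _ hst => ?_⟩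
  rw [lintegral_congr_ae (ae_restrict_of_ae (metricSpeed_comp_clamp hab γ)),
    setLIntegral_indicator measurableSet_Icc]
  rcases (clamp_mono a b hst).eq_or_lt with h | h
  · simp [h]
  · refine (hγ.edist_le (clamp_mono a b hst)).trans (lintegral_mono_set fun r hr => ?_)
    rw [clamp_apply, clamp_apply] at h hr
    grind

variable [MeasurableSpace X] [BorelSpace X]

theorem measurable_eval_curve (t : I) : Measurable (fun γ : C(I, X) => γ t) :=
  (ContinuousEvalConst.continuous_eval_const t).measurable

theorem measurable_eval_prod [SecondCountableTopology X] :
    Measurable (fun p : C(I, X) × I => p.1 p.2) :=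
  Continuous.measurable (by fun_prop)

/-- Conditioning multiplies the compression constant by at most `1 / π A`; stopping only samples the
old curve at other times and does not increase its energy. The `AC²` property is pushed forward
through the measurable set `speedBounded D`. -/
theorem IsTestPlan.cond_stop [SecondCountableTopology X] {m : Measure X} {π : Measure C(I, X)}
    (hπ : IsTestPlan m π) {A : Set C(I, X)} (hA : π A ≠ 0) {a b : I}
    (hab : a ≤ b) :
    IsTestPlan m ((ProbabilityTheory.cond π A).map fun γ => γ.comp (clamp a b)) := by
  have hprob := hπ.isProbabilityMeasure
  have hF := measurable_comp_clamp (X := X) a b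
  have hcond : ProbabilityTheory.cond π A ≪ π := ProbabilityTheory.cond_absolutelyContinuous
  have hspeed : Measurable (fun γ : C(I, X) => ∫⁻ t : I, metricSpeed γ t ^ 2) :=
    (measurable_metricSpeed.pow_const 2).lintegral_prod_right'
  refine ⟨?_, ?_, ?_, ?_⟩
  · have := ProbabilityTheory.cond_isProbabilityMeasure hA
    exact Measure.isProbabilityMeasure_map hF.aemeasurable
  · obtain ⟨C, hC⟩ := hπ.bounded_compression
    refine ⟨((π A)⁻¹).toNNReal * C, fun t => ?_⟩
    rw [Measure.map_map (measurable_eval_curve t) hF]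
    change (ProbabilityTheory.cond π A).map (fun γ : C(I, X) => γ (clamp a b t)) ≤ _
    refine Measure.le_iff.2 fun s hs => ?_
    have h1 := Measure.le_iff.1 (hC (clamp a b t)) s hs
    rw [Measure.map_apply (measurable_eval_curve _) hs] at h1 ⊢
    rw [ProbabilityTheory.cond, Measure.smul_apply, mul_smul, Measure.smul_apply,
      smul_eq_mul, ENNReal.smul_def, smul_eq_mul, ENNReal.coe_toNNReal (ENNReal.inv_ne_top.2 hA)]
    gcongr
    exact (Measure.restrict_apply_le _ _).trans h1
  · obtain ⟨D, hDc, hD⟩ := TopologicalSpace.exists_countable_dense I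
    have h1 : ∀ᵐ γ ∂((ProbabilityTheory.cond π A).map fun γ => γ.comp (clamp a b)),
        γ ∈ speedBounded D := by
      refine (ae_map_iff hF.aemeasurable (measurableSet_speedBounded hDc)).2 (hcond.ae_le ?_)
      filter_upwards [hπ.ae_isAC2, ae_lt_top hspeed hπ.finite_energy.ne] with γ h1 h2
      exact comp_clamp_mem_speedBounded hab D h1 h2
    filter_upwards [h1] with γ hγ using isAC2_of_speedBounded hD hγ
  · rw [lintegral_map hspeed hF, ProbabilityTheory.cond, lintegral_smul_measure, smul_eq_mul]
    refine ENNReal.mul_lt_top (ENNReal.inv_lt_top.2 (pos_iff_ne_zero.2 hA)) ?_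
    refine ((setLIntegral_le_lintegral _ _).trans (lintegral_mono fun γ => ?_)).trans_lt
      hπ.finite_energy
    exact lintegral_speed_sq_comp_clamp_le hab γ

/-- The product of a function along a curve and the metric speed. -/
def speedMul (G : X → ℝ) (γ : C(I, X)) (t : I) : ℝ≥0∞ :=
  ENNReal.ofReal (G (γ t)) * metricSpeed γ t

theorem measurable_speedMul [SecondCountableTopology X] {G : X → ℝ} (hG : Measurable G) :
    Measurable (fun p : C(I, X) × I => speedMul G p.1 p.2) :=
  (hG.comp measurable_eval_prod).ennreal_ofReal.mul measurable_metricSpeed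

theorem measurable_speedMul_curve [SecondCountableTopology X] {G : X → ℝ} (hG : Measurable G)
    (γ : C(I, X)) : Measurable (speedMul G γ) :=
  (hG.comp γ.continuous.measurable).ennreal_ofReal.mul (measurable_metricSpeed_curve γ)

/-- Testing with `π` conditioned on an arbitrary measurable set `A` and stopped to `[a, b]` gives
the inequality integrated over `A`. As `A` is arbitrary, it holds for almost every curve. -/
theorem IsWeakUpperGradient.ae_sub_le [SecondCountableTopology X] {m : Measure X} {f G : X → ℝ}
    (hf : Measurable f) (hG : IsWeakUpperGradient m f G) {π : Measure C(I, X)}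
    (hπ : IsTestPlan m π) {a b : I} (hab : a ≤ b) :
    ∀ᵐ γ ∂π, ENNReal.ofReal |f (γ b) - f (γ a)| ≤ ∫⁻ r in Icc a b, speedMul G γ r := by
  have hprob := hπ.isProbabilityMeasure
  refine ae_le_of_forall_setLIntegral_le_of_sigmaFinite ?_ fun A _ _ => ?_
  · have h1 := hf.comp (measurable_eval_curve (X := X) a)
    have h2 := hf.comp (measurable_eval_curve (X := X) b)
    exact (continuous_abs.measurable.comp (h2.sub h1)).ennreal_ofReal
  by_cases hA0 : π A = 0
  · simp [Measure.restrict_eq_zero.2 hA0]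
  have h1 := hG.lintegral_le _ (hπ.cond_stop hA0 hab)
  have hF := measurable_comp_clamp (X := X) a b
  have hm1 : Measurable (fun γ : C(I, X) => ENNReal.ofReal |f (γ 1) - f (γ 0)|) := by
    have h1 := hf.comp (measurable_eval_curve (X := X) 0)
    have h2 := hf.comp (measurable_eval_curve (X := X) 1)
    exact (continuous_abs.measurable.comp (h2.sub h1)).ennreal_ofReal
  have hm2 : Measurable (fun γ : C(I, X) => ∫⁻ t : I, speedMul G γ t) :=
    (measurable_speedMul hG.measurable).lintegral_prod_right'
  rw [lintegral_map hm1 hF] at h1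
  change _ ≤ ∫⁻ γ, (∫⁻ t : I, speedMul G γ t) ∂_ at h1
  rw [lintegral_map hm2 hF, ProbabilityTheory.cond, lintegral_smul_measure, lintegral_smul_measure,
    smul_eq_mul, smul_eq_mul, ENNReal.mul_le_mul_iff_right (ENNReal.inv_ne_zero.2 (measure_ne_top _ _))
    (ENNReal.inv_ne_top.2 hA0)] at h1
  simp only [ContinuousMap.comp_apply, clamp_zero hab, clamp_one hab] at h1
  refine h1.trans (lintegral_mono fun γ => ?_)
  rw [← lintegral_indicator measurableSet_Icc]
  refine lintegral_mono_ae ?_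
  filter_upwards [metricSpeed_comp_clamp hab γ] with r hr
  rw [speedMul, hr]
  by_cases h : r ∈ Icc a b
  · rw [indicator_of_mem h, indicator_of_mem h, ContinuousMap.comp_apply, clamp_of_mem h, speedMul]
  · rw [indicator_of_notMem h, indicator_of_notMem h, mul_zero]

end Stop

/-! ### Absolutely continuous representatives along almost every curve -/

section Representative

variable {X : Type*} [MetricSpace X]

/-- `U` is an absolutely continuous representative of `f ∘ γ` with the same endpoints. -/
structure IsACRep (f : X → ℝ) (γ : C(I, X)) (U : ℝ → ℝ) : Prop where
  aci : ACI U
  zero : U 0 = f (γ 0)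
  one : U 1 = f (γ 1)
  ae_eq : ∀ᵐ t : I, U t = f (γ t)

theorem IsACRep.eqOn {f : X → ℝ} {γ : C(I, X)} {U V : ℝ → ℝ} (hU : IsACRep f γ U)
    (hV : IsACRep f γ V) : EqOn U V (Icc 0 1) :=
  hU.aci.eqOn_of_ae hV.aci (by filter_upwards [hU.ae_eq, hV.ae_eq] with t h1 h2; rw [h1, h2])

theorem IsACRep.ae_deriv_eq {f : X → ℝ} {γ : C(I, X)} {U V : ℝ → ℝ} (hU : IsACRep f γ U)
    (hV : IsACRep f γ V) : ∀ᵐ t : I, deriv U t = deriv V t :=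
  ae_deriv_eq_of_eqOn (hU.eqOn hV)

variable [MeasurableSpace X] [BorelSpace X] [SecondCountableTopology X]

/-- Use `ab ≤ a² + b²`: the speed is covered by the kinetic energy, and bounded compression bounds
the integral of `G²` along curves by `C ∫ G² dm`. -/
theorem IsTestPlan.lintegral_speedMul_lt_top {m : Measure X} {π : Measure C(I, X)}
    (hπ : IsTestPlan m π) {G : X → ℝ} (hG : Measurable G) (hG2 : MemLp G 2 m) :
    ∀ᵐ γ ∂π, ∫⁻ t, speedMul G γ t < ∞ := by
  have hprob := hπ.isProbabilityMeasure
  have hspeed : Measurable (fun γ : C(I, X) => ∫⁻ t : I, metricSpeed γ t ^ 2) :=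
    (measurable_metricSpeed.pow_const 2).lintegral_prod_right'
  have hGm : Measurable (fun p : C(I, X) × I => ENNReal.ofReal (G (p.1 p.2)) ^ 2) :=
    (hG.comp measurable_eval_prod).ennreal_ofReal.pow_const 2
  have hGm' : Measurable (fun x => ENNReal.ofReal (G x) ^ 2) := hG.ennreal_ofReal.pow_const 2
  have hfin : ∫⁻ x, ENNReal.ofReal (G x) ^ 2 ∂m < ∞ := by
    have h1 := ((memLp_two_iff_integrable_sq hG2.1).1 hG2).2
    rw [hasFiniteIntegral_iff_enorm] at h1
    refine (lintegral_mono fun x => ?_).trans_lt h1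
    rw [← ofReal_norm, Real.norm_eq_abs, abs_pow, ENNReal.ofReal_pow (abs_nonneg _)]
    gcongr
    exact le_abs_self _
  obtain ⟨C, hC⟩ := hπ.bounded_compression
  have h1 : ∫⁻ γ, (∫⁻ t : I, ENNReal.ofReal (G (γ t)) ^ 2) ∂π < ∞ := by
    rw [lintegral_lintegral_swap hGm.aemeasurable]
    refine (lintegral_mono (g := fun _ => C * ∫⁻ x, ENNReal.ofReal (G x) ^ 2 ∂m) fun t => ?_).trans_lt ?_
    · rw [← lintegral_map (f := fun x => ENNReal.ofReal (G x) ^ 2) hGm' (measurable_eval_curve t)]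
      refine (lintegral_mono' (hC t) le_rfl).trans (le_of_eq ?_)
      rw [lintegral_smul_measure, ENNReal.smul_def, smul_eq_mul]
    · rw [lintegral_const, measure_univ, mul_one]
      exact ENNReal.mul_lt_top ENNReal.coe_lt_top hfin
  filter_upwards [ae_lt_top hspeed hπ.finite_energy.ne,
    ae_lt_top hGm.lintegral_prod_right' h1.ne] with γ h2 h3
  refine (lintegral_mono (g := fun t => ENNReal.ofReal (G (γ t)) ^ 2 + metricSpeed γ t ^ 2)
    fun t => ?_).trans_lt ?_
  · rw [speedMul]
    rcases le_total (ENNReal.ofReal (G (γ t))) (metricSpeed γ t) with h | h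
    · refine le_add_left ?_
      rw [sq]; gcongr
    · refine le_add_right ?_
      rw [sq]; gcongr
  · rw [lintegral_add_right _ ((measurable_metricSpeed_curve γ).pow_const 2)]
    exact ENNReal.add_lt_top.2 ⟨h3, h2⟩

/-- A weak upper gradient controls the derivative of `f` along almost every curve. -/
theorem IsWeakUpperGradient.exists_rep {m : Measure X} {f G : X → ℝ} (hf : Measurable f)
    (hG : IsWeakUpperGradient m f G) {π : Measure C(I, X)} (hπ : IsTestPlan m π) :
    ∀ᵐ γ ∂π, ∃ U : ℝ → ℝ, IsACRep f γ U ∧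
      ∀ᵐ t : I, ENNReal.ofReal |deriv U t| ≤ speedMul G γ t := by
  have hprob := hπ.isProbabilityMeasure
  obtain ⟨D₀, hD₀c, hD₀⟩ := TopologicalSpace.exists_countable_dense I
  -- The endpoints are included so that the representative has the correct values at `0` and `1`,
  -- not merely at almost every time.
  set D : Set I := insert 0 (insert 1 D₀)
  have hDc : D.Countable := (hD₀c.insert 1).insert 0
  have hD : Dense D := hD₀.mono ((subset_insert _ _).trans (subset_insert _ _))
  have hgm := measurable_speedMul hG.measurable
  let P : C(I, X) → I → I → Prop := fun γ q t =>
    ENNReal.ofReal |f (γ t) - f (γ q)| ≤ ∫⁻ r in Icc (min q t) (max q t), speedMul G γ r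
  have hP : ∀ q t : I, ∀ᵐ γ ∂π, P γ q t := by
    intro q t
    rcases le_total q t with h | h
    · simp only [P, min_eq_left h, max_eq_right h]
      exact hG.ae_sub_le hf hπ h
    · simp only [P, min_eq_right h, max_eq_left h]
      filter_upwards [hG.ae_sub_le hf hπ h] with γ hγ
      rwa [abs_sub_comm]
  have hPm : ∀ q : I, MeasurableSet {p : I × C(I, X) | P p.2 q p.1} := by
    intro q
    have he : Measurable (fun p : I × C(I, X) => p.2 p.1) := Continuous.measurable (by fun_prop)
    have he' : Measurable (fun p : I × C(I, X) => p.2 q) := Continuous.measurable (by fun_prop)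
    refine measurableSet_le ?_ ?_
    · exact (continuous_abs.measurable.comp ((hf.comp he).sub (hf.comp he'))).ennreal_ofReal
    · simp only [← lintegral_indicator measurableSet_Icc]
      have hS : MeasurableSet {z : (I × C(I, X)) × I | min q z.1.1 ≤ z.2 ∧ z.2 ≤ max q z.1.1} :=
        (measurableSet_le (by fun_prop) (by fun_prop)).inter
          (measurableSet_le (by fun_prop) (by fun_prop))
      have h1 : Measurable (fun z : (I × C(I, X)) × I => speedMul G z.1.2 z.2) :=
        hgm.comp ((measurable_snd.comp measurable_fst).prodMk measurable_snd)
      exact (h1.indicator hS).lintegral_prod_right'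
  have hPae : ∀ᵐ γ ∂π, ∀ q ∈ D, ∀ᵐ t : I, P γ q t :=
    (ae_ball_iff hDc).2 fun q _ => (Measure.ae_ae_comm (μ := (volume : Measure I)) (ν := π)
      (p := fun t γ => P γ q t) (hPm q)).1 (Eventually.of_forall (hP q))
  have hPD : ∀ᵐ γ ∂π, ∀ q ∈ D, ∀ t ∈ D, P γ q t :=
    (ae_ball_iff hDc).2 fun q _ => (ae_ball_iff hDc).2 fun t _ => hP q t
  filter_upwards [hPae, hPD, hπ.lintegral_speedMul_lt_top hG.measurable hG.memLp]
    with γ h1 h2 hfin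
  have hm := measurable_speedMul_curve hG.measurable γ
  -- By Fubini `T` has full measure for almost every curve. Two points of `T` are compared through a
  -- point of `D` between them, so only countably many reference times are ever needed.
  set T : Set I := {t | ∀ q ∈ D, P γ q t}
  have hTae : ∀ᵐ t : I, t ∈ T := (ae_ball_iff hDc).2 h1
  have hDT : D ⊆ T := fun t ht q hq => h2 q hq t ht
  have key : ∀ s ∈ T, ∀ t ∈ T, s ≤ t →
      |f (γ t) - f (γ s)| ≤ ∫ r in (s : ℝ)..t, toLine (speedMul G γ) r := by
    intro s hs t ht hst
    rcases hst.eq_or_lt with rfl | hlt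
    · simp
    obtain ⟨q, hq, hsq, hqt⟩ := hD.exists_between hlt
    have h3 := hs q hq
    have h4 := ht q hq
    simp only [P, min_eq_left hqt.le, max_eq_right hqt.le, min_eq_right hsq.le,
      max_eq_left hsq.le] at h3 h4
    rw [← ofReal_integral_toLine hm hfin hsq.le] at h3
    rw [← ofReal_integral_toLine hm hfin hqt.le] at h4
    rw [ENNReal.ofReal_le_ofReal_iff (intervalIntegral.integral_nonneg (show (s : ℝ) ≤ q from hsq.le)
      fun r _ => toLine_nonneg _ _)] at h3
    rw [ENNReal.ofReal_le_ofReal_iff (intervalIntegral.integral_nonneg (show (q : ℝ) ≤ t from hqt.le)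
      fun r _ => toLine_nonneg _ _)] at h4
    have hint := intervalIntegrable_toLine hm hfin
    have hi : ∀ a b : I, IntervalIntegrable (toLine (speedMul G γ)) volume a b := fun a b =>
      hint.mono_set (by rw [uIcc_of_le zero_le_one]; exact uIcc_subset_Icc a.2 b.2)
    rw [← intervalIntegral.integral_add_adjacent_intervals (hi s q) (hi q t)]
    rw [abs_sub_comm] at h3
    have := abs_sub_le (f (γ t)) (f (γ q)) (f (γ s))
    linarith
  obtain ⟨U, hU, hUe, hUd⟩ := exists_ACI_extension (T := Subtype.val '' T)
    (u := fun t => f (γ (projIcc 0 1 zero_le_one t))) (g := toLine (speedMul G γ))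
    (by rintro _ ⟨t, -, rfl⟩; exact t.2)
    (intervalIntegrable_toLine hm hfin) (toLine_nonneg _) (by
      rintro _ ⟨s, hs, rfl⟩ _ ⟨t, ht, rfl⟩ hst
      simpa using key s hs t ht hst)
  have hUe' : ∀ t ∈ T, U t = f (γ t) := fun t ht => by
    simpa using hUe (mem_image_of_mem Subtype.val ht)
  refine ⟨U, ⟨hU, ?_, ?_, ?_⟩, ?_⟩
  · simpa using hUe' 0 (hDT (mem_insert _ _))
  · simpa using hUe' 1 (hDT (mem_insert_of_mem _ (mem_insert _ _)))
  · filter_upwards [hTae] with t ht using hUe' t ht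
  · filter_upwards [hUd] with t ht
    refine (ENNReal.ofReal_le_ofReal ht).trans ?_
    rw [toLine_coe]
    exact ENNReal.ofReal_toReal_le

/-- A function which controls the derivative of `f` along almost every curve is a weak upper
gradient. -/
theorem IsWeakUpperGradient.of_rep {m : Measure X} {f G : X → ℝ} (hGm : Measurable G)
    (hG0 : ∀ x, 0 ≤ G x) (hG2 : MemLp G 2 m)
    (h : ∀ π : Measure C(I, X), IsTestPlan m π → ∀ᵐ γ ∂π, ∃ U : ℝ → ℝ, IsACRep f γ U ∧
      ∀ᵐ t : I, ENNReal.ofReal |deriv U t| ≤ speedMul G γ t) : IsWeakUpperGradient m f G := by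
  refine ⟨hGm, hG0, hG2, fun π hπ => lintegral_mono_ae ?_⟩
  filter_upwards [h π hπ] with γ hγ
  obtain ⟨U, hU, hUd⟩ := hγ
  rw [← hU.zero, ← hU.one]
  exact hU.aci.abs_sub_le.trans (lintegral_mono_ae hUd)

end Representative

/-! ### Minimal weak upper gradients: existence, locality and calculus inequalities -/

section Calculus

variable {X : Type*} [MetricSpace X] [MeasurableSpace X] [BorelSpace X]
  [SecondCountableTopology X] {m : Measure X} {f g : X → ℝ}

/-- The metric speed as a real number. -/
def realSpeed (γ : C(I, X)) (t : I) : ℝ := (metricSpeed γ t).toReal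

theorem realSpeed_nonneg (γ : C(I, X)) (t : I) : 0 ≤ realSpeed γ t := ENNReal.toReal_nonneg

theorem IsTestPlan.ae_speed_lt_top {π : Measure C(I, X)} (hπ : IsTestPlan m π) :
    ∀ᵐ γ ∂π, ∀ᵐ t : I, metricSpeed γ t < ∞ := by
  have hspeed : Measurable (fun γ : C(I, X) => ∫⁻ t : I, metricSpeed γ t ^ 2) :=
    (measurable_metricSpeed.pow_const 2).lintegral_prod_right'
  filter_upwards [ae_lt_top hspeed hπ.finite_energy.ne] with γ hγ
  exact ae_lt_top (measurable_metricSpeed_curve γ) (lintegral_speed_lt_top hγ).ne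

theorem IsWeakUpperGradient.exists_rep_real {G : X → ℝ} (hf : Measurable f)
    (hG : IsWeakUpperGradient m f G) {π : Measure C(I, X)} (hπ : IsTestPlan m π) :
    ∀ᵐ γ ∂π, ∃ U : ℝ → ℝ, IsACRep f γ U ∧ ∀ᵐ t : I, |deriv U t| ≤ G (γ t) * realSpeed γ t := by
  filter_upwards [hG.exists_rep hf hπ, hπ.ae_speed_lt_top] with γ h1 h2
  obtain ⟨U, hU, hUd⟩ := h1
  refine ⟨U, hU, ?_⟩
  filter_upwards [hUd, h2] with t h3 h4
  rw [speedMul, ← ENNReal.ofReal_toReal h4.ne, ← ENNReal.ofReal_mul (hG.nonneg _)] at h3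
  exact (ENNReal.ofReal_le_ofReal_iff (mul_nonneg (hG.nonneg _) (realSpeed_nonneg _ _))).1 h3

theorem IsWeakUpperGradient.of_rep_real {G : X → ℝ} (hGm : Measurable G)
    (hG0 : ∀ x, 0 ≤ G x) (hG2 : MemLp G 2 m)
    (h : ∀ π : Measure C(I, X), IsTestPlan m π → ∀ᵐ γ ∂π, ∃ U : ℝ → ℝ, IsACRep f γ U ∧
      ∀ᵐ t : I, |deriv U t| ≤ G (γ t) * realSpeed γ t) : IsWeakUpperGradient m f G := by
  refine IsWeakUpperGradient.of_rep hGm hG0 hG2 fun π hπ => ?_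
  filter_upwards [h π hπ] with γ h1
  obtain ⟨U, hU, hUd⟩ := h1
  refine ⟨U, hU, ?_⟩
  filter_upwards [hUd] with t h3
  refine (ENNReal.ofReal_le_ofReal h3).trans ?_
  rw [speedMul, ENNReal.ofReal_mul (hG0 _)]
  gcongr
  exact ENNReal.ofReal_toReal_le

/-- Two representatives along the same curve agree on `[0, 1]`, so a single `U` satisfies all the
countably many derivative bounds at almost every time. -/
theorem IsWeakUpperGradient.iInf {ι : Type*} [Countable ι] [Nonempty ι] {G : ι → X → ℝ}
    (hf : Measurable f) (hG : ∀ i, IsWeakUpperGradient m f (G i)) :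
    IsWeakUpperGradient m f (fun x => ⨅ i, G i x) := by
  have hbdd : ∀ x, BddBelow (range fun i => G i x) := fun x =>
    ⟨0, by rintro _ ⟨i, rfl⟩; exact (hG i).nonneg x⟩
  have h0 : ∀ x, 0 ≤ ⨅ i, G i x := fun x => le_ciInf fun i => (hG i).nonneg x
  have hm : Measurable fun x => ⨅ i, G i x := Measurable.iInf fun i => (hG i).measurable
  obtain ⟨i₀⟩ := ‹Nonempty ι›
  have : Nonempty ι := ⟨i₀⟩
  refine .of_rep_real hm h0 ((hG i₀).memLp.mono hm.aestronglyMeasurable ?_) fun π hπ => ?_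
  · refine Eventually.of_forall fun x => ?_
    rw [Real.norm_of_nonneg (h0 x), Real.norm_of_nonneg ((hG i₀).nonneg x)]
    exact ciInf_le (hbdd x) i₀
  · filter_upwards [ae_all_iff.2 fun i => (hG i).exists_rep_real hf hπ] with γ hγ
    obtain ⟨U, hU, -⟩ := hγ i₀
    refine ⟨U, hU, ?_⟩
    have : ∀ i, ∀ᵐ t : I, |deriv U t| ≤ G i (γ t) * realSpeed γ t := by
      intro i
      obtain ⟨V, hV, hVd⟩ := hγ i
      filter_upwards [hVd, hU.ae_deriv_eq hV] with t h1 h2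
      rwa [h2]
    filter_upwards [ae_all_iff.2 this] with t ht
    rw [Real.iInf_mul_of_nonneg (realSpeed_nonneg γ t)]
    exact le_ciInf ht

theorem IsWeakUpperGradient.integrable_sq {G : X → ℝ} (hG : IsWeakUpperGradient m f G) :
    Integrable (fun x => G x ^ 2) m := (memLp_two_iff_integrable_sq hG.memLp.1).1 hG.memLp

/-- Minimise `∫ G²`: the pointwise infimum `F` of a minimising sequence is an upper gradient
attaining the infimum. For any competitor `H`, `min F H` is again an upper gradient and cannot have
a smaller integral, so `F = min F H` a.e. -/
theorem IsSobolev.exists_minimal (hf : IsSobolev m f) :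
    ∃ G, IsMinimalWeakUpperGradient m f G := by
  obtain ⟨hfm, G₀, hG₀⟩ := hf
  set S : Set ℝ := (fun G : X → ℝ => ∫ x, G x ^ 2 ∂m) '' {G | IsWeakUpperGradient m f G}
  have hSb : BddBelow S := ⟨0, by
    rintro _ ⟨G, -, rfl⟩
    exact integral_nonneg fun x => sq_nonneg _⟩
  obtain ⟨u, -, hu, huS⟩ := exists_seq_tendsto_sInf (S := S) ⟨_, G₀, hG₀, rfl⟩ hSb
  choose G hG hGu using huS
  have hG' := IsWeakUpperGradient.iInf hfm hG
  have hle : ∫ x, (⨅ n, G n x) ^ 2 ∂m ≤ sInf S := by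
    refine ge_of_tendsto' hu fun n => ?_
    rw [← hGu]
    refine integral_mono hG'.integrable_sq (hG n).integrable_sq fun x => ?_
    have h1 : ⨅ n, G n x ≤ G n x :=
      ciInf_le ⟨0, by rintro _ ⟨i, rfl⟩; exact (hG i).nonneg x⟩ n
    exact pow_le_pow_left₀ (hG'.nonneg x) h1 2
  refine ⟨_, hG', fun H hH => ?_⟩
  set F : X → ℝ := fun x => ⨅ n, G n x
  have hK := IsWeakUpperGradient.iInf (ι := Bool) (G := fun b => cond b F H) hfm (by
    rintro (_ | _)
    · exact hH
    · exact hG')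
  have hKe : (fun x => ⨅ b : Bool, (cond b F H : X → ℝ) x) = fun x => min (F x) (H x) := by
    ext x
    have hb : BddBelow (range fun b : Bool => (cond b F H : X → ℝ) x) := (Set.finite_range _).bddBelow
    refine le_antisymm (le_min (ciInf_le hb true) (ciInf_le hb false)) (le_ciInf ?_)
    rintro (_ | _)
    · exact min_le_right _ _
    · exact min_le_left _ _
  rw [hKe] at hK
  have h1 : sInf S ≤ ∫ x, (min (F x) (H x)) ^ 2 ∂m := csInf_le hSb ⟨_, hK, rfl⟩
  have h2 : ∀ x, 0 ≤ F x ^ 2 - min (F x) (H x) ^ 2 := fun x =>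
    sub_nonneg.2 (pow_le_pow_left₀ (hK.nonneg x) (min_le_left _ _) 2)
  have h3 : ∫ x, (F x ^ 2 - min (F x) (H x) ^ 2) ∂m = 0 := by
    refine le_antisymm ?_ (integral_nonneg h2)
    rw [integral_sub hG'.integrable_sq hK.integrable_sq]
    linarith
  rw [integral_eq_zero_iff_of_nonneg h2 (hG'.integrable_sq.sub hK.integrable_sq)] at h3
  filter_upwards [h3] with x hx
  have h4 : F x ^ 2 - min (F x) (H x) ^ 2 = 0 := hx
  have h5 : F x = min (F x) (H x) :=
    (pow_left_inj₀ (hG'.nonneg x) (hK.nonneg x) two_ne_zero).1 (sub_eq_zero.1 h4)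
  rw [h5]
  exact min_le_right _ _

theorem IsSobolev.minGrad_spec (hf : IsSobolev m f) :
    IsMinimalWeakUpperGradient m f (minGrad m f) := by
  have h := hf.exists_minimal
  rw [minGrad, dif_pos h]
  exact h.choose_spec

theorem IsSobolev.minGrad_wug (hf : IsSobolev m f) : IsWeakUpperGradient m f (minGrad m f) :=
  hf.minGrad_spec.1

theorem IsWeakUpperGradient.isSobolev {G : X → ℝ} (hG : IsWeakUpperGradient m f G)
    (hf : Measurable f) : IsSobolev m f := ⟨hf, G, hG⟩

theorem IsWeakUpperGradient.minGrad_le {G : X → ℝ} (hG : IsWeakUpperGradient m f G)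
    (hf : Measurable f) : ∀ᵐ x ∂m, minGrad m f x ≤ G x :=
  (hG.isSobolev hf).minGrad_spec.2 G hG

theorem minGrad_nonneg (m : Measure X) (f : X → ℝ) (x : X) : 0 ≤ minGrad m f x := by
  by_cases h : ∃ G, IsMinimalWeakUpperGradient m f G
  · rw [minGrad, dif_pos h]; exact h.choose_spec.1.nonneg x
  · rw [minGrad, dif_neg h]; exact le_rfl

theorem measurable_minGrad (m : Measure X) (f : X → ℝ) : Measurable (minGrad m f) := by
  by_cases h : ∃ G, IsMinimalWeakUpperGradient m f G
  · rw [minGrad, dif_pos h]; exact h.choose_spec.1.measurable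
  · rw [minGrad, dif_neg h]; exact measurable_const

theorem IsSobolev.linear_wug (hf : IsSobolev m f) (hg : IsSobolev m g) (α β : ℝ) :
    IsWeakUpperGradient m (fun x => α * f x + β * g x)
      (fun x => |α| * minGrad m f x + |β| * minGrad m g x) := by
  have hF := hf.minGrad_wug
  have hG := hg.minGrad_wug
  refine .of_rep_real ((hF.measurable.const_mul _).add (hG.measurable.const_mul _))
    (fun x => add_nonneg (mul_nonneg (abs_nonneg _) (hF.nonneg x))
      (mul_nonneg (abs_nonneg _) (hG.nonneg x)))
    ((hF.memLp.const_mul _).add (hG.memLp.const_mul _)) fun π hπ => ?_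
  filter_upwards [hF.exists_rep_real hf.1 hπ, hG.exists_rep_real hg.1 hπ] with γ h1 h2
  obtain ⟨U, hU, hUd⟩ := h1
  obtain ⟨V, hV, hVd⟩ := h2
  refine ⟨fun t => α * U t + β * V t, ⟨(hU.aci.const_mul α).add (hV.aci.const_mul β), ?_, ?_, ?_⟩, ?_⟩
  · simp only [hU.zero, hV.zero]
  · simp only [hU.one, hV.one]
  · filter_upwards [hU.ae_eq, hV.ae_eq] with t h3 h4
    rw [h3, h4]
  · filter_upwards [hUd, hVd, hU.aci.ae_differentiableAt, hV.aci.ae_differentiableAt]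
      with t h3 h4 h5 h6
    rw [deriv_fun_add (h5.const_mul α) (h6.const_mul β), deriv_const_mul _ h5, deriv_const_mul _ h6]
    refine (abs_add_le _ _).trans ?_
    rw [abs_mul, abs_mul]
    nlinarith [abs_nonneg α, abs_nonneg β]

theorem IsSobolev.linear (hf : IsSobolev m f) (hg : IsSobolev m g) (α β : ℝ) :
    IsSobolev m (fun x => α * f x + β * g x) :=
  (hf.linear_wug hg α β).isSobolev ((hf.1.const_mul α).add (hg.1.const_mul β))

theorem IsSobolev.minGrad_linear_le (hf : IsSobolev m f) (hg : IsSobolev m g) (α β : ℝ) :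
    ∀ᵐ x ∂m, minGrad m (fun x => α * f x + β * g x) x ≤
      |α| * minGrad m f x + |β| * minGrad m g x :=
  (hf.linear_wug hg α β).minGrad_le ((hf.1.const_mul α).add (hg.1.const_mul β))

/-- Along curves the derivative of `U` vanishes a.e. where `U` takes values in a null set, so
cutting the gradient off on the preimage leaves an upper gradient; minimality concludes. -/
theorem IsSobolev.minGrad_eq_zero_of_mem_null (hf : IsSobolev m f) {N : Set ℝ}
    (hN : volume N = 0) : ∀ᵐ x ∂m, f x ∈ N → minGrad m f x = 0 := by
  obtain ⟨N', hNN', hN'm, hN'⟩ := exists_measurable_superset_of_null hN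
  have hF := hf.minGrad_wug
  have hS : MeasurableSet (f ⁻¹' N')ᶜ := (hf.1 hN'm).compl
  have hW : IsWeakUpperGradient m f ((f ⁻¹' N')ᶜ.indicator (minGrad m f)) := by
    refine .of_rep_real (hF.measurable.indicator hS) (fun x => indicator_nonneg (fun x _ => hF.nonneg x) x)
      (hF.memLp.indicator hS) fun π hπ => ?_
    filter_upwards [hF.exists_rep_real hf.1 hπ] with γ h1
    obtain ⟨U, hU, hUd⟩ := h1
    refine ⟨U, hU, ?_⟩
    filter_upwards [hUd, hU.aci.ae_deriv_eq_zero hN', hU.ae_eq] with t h2 h3 h4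
    by_cases h5 : f (γ t) ∈ N'
    · rw [indicator_of_notMem (show γ t ∉ (f ⁻¹' N')ᶜ from notMem_compl_iff.2 h5), h3 (by rwa [h4])]
      simp
    · rwa [indicator_of_mem (show γ t ∈ (f ⁻¹' N')ᶜ from h5)]
  filter_upwards [hW.minGrad_le hf.1] with x hx hxN
  rw [indicator_of_notMem (show x ∉ (f ⁻¹' N')ᶜ from notMem_compl_iff.2 (hNN' hxN))] at hx
  exact le_antisymm hx (minGrad_nonneg m f x)

/-- Locality: `f = g + (f - g)`, and `|D(f - g)|` vanishes where `f - g` takes values in the null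
set `{0}`. -/
theorem minGrad_eq_of_eq (hf : IsSobolev m f) (hg : IsSobolev m g) :
    ∀ᵐ x ∂m, f x = g x → minGrad m f x = minGrad m g x := by
  have key : ∀ {f g : X → ℝ}, IsSobolev m f → IsSobolev m g →
      ∀ᵐ x ∂m, f x = g x → minGrad m f x ≤ minGrad m g x := by
    intro f g hf hg
    have hd := hf.linear hg 1 (-1)
    have h1 := hg.minGrad_linear_le hd 1 1
    have h2 : (fun x => 1 * g x + 1 * (1 * f x + -1 * g x)) = f := by ext x; ring
    rw [h2] at h1
    filter_upwards [h1, hd.minGrad_eq_zero_of_mem_null (N := {0}) (by simp)] with x h3 h4 h5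
    rw [h4 (by simp [h5])] at h3
    simpa using h3
  filter_upwards [key hf hg, key hg hf] with x h1 h2 h3
  exact le_antisymm (h1 h3) (h2 h3.symm)

theorem IsSobolev.comp_wug (hf : IsSobolev m f) {φ : ℝ → ℝ} {K : ℝ≥0} (hφ : LipschitzWith K φ) :
    IsWeakUpperGradient m (fun x => φ (f x)) (fun x => |deriv φ (f x)| * minGrad m f x) := by
  have hF := hf.minGrad_wug
  have hm : Measurable (fun x => |deriv φ (f x)| * minGrad m f x) :=
    (continuous_abs.measurable.comp ((measurable_deriv φ).comp hf.1)).mul hF.measurable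
  refine .of_rep_real hm (fun x => mul_nonneg (abs_nonneg _) (hF.nonneg x))
    ((hF.memLp.const_mul (K : ℝ)).mono hm.aestronglyMeasurable ?_) fun π hπ => ?_
  · refine Eventually.of_forall fun x => ?_
    have h1 := norm_deriv_le_of_lipschitz hφ (x₀ := f x)
    rw [norm_mul, norm_mul, Real.norm_eq_abs, abs_abs, ← Real.norm_eq_abs,
      Real.norm_of_nonneg K.coe_nonneg]
    gcongr
  · filter_upwards [hF.exists_rep_real hf.1 hπ] with γ h1
    obtain ⟨U, hU, hUd⟩ := h1
    refine ⟨fun t => φ (U t), ⟨hU.aci.comp_lipschitz hφ, ?_, ?_, ?_⟩, ?_⟩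
    · simp only [hU.zero]
    · simp only [hU.one]
    · filter_upwards [hU.ae_eq] with t h3
      rw [h3]
    · filter_upwards [hUd, hU.ae_eq, hU.aci.ae_deriv_comp hφ] with t h3 h4 h5
      rw [h5, h4, abs_mul, mul_assoc]
      gcongr

theorem IsSobolev.comp (hf : IsSobolev m f) {φ : ℝ → ℝ} {K : ℝ≥0} (hφ : LipschitzWith K φ) :
    IsSobolev m (fun x => φ (f x)) :=
  (hf.comp_wug hφ).isSobolev (hφ.continuous.measurable.comp hf.1)

theorem IsSobolev.minGrad_comp_le (hf : IsSobolev m f) {φ : ℝ → ℝ} {K : ℝ≥0}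
    (hφ : LipschitzWith K φ) :
    ∀ᵐ x ∂m, minGrad m (fun x => φ (f x)) x ≤ |deriv φ (f x)| * minGrad m f x :=
  (hf.comp_wug hφ).minGrad_le (hφ.continuous.measurable.comp hf.1)

/-- The product rule for representatives; the bounds serve to keep the candidate gradient in `L²`.
-/
theorem IsSobolev.mul_wug (hf : IsSobolev m f) (hg : IsSobolev m g) {M N : ℝ}
    (hfM : ∀ᵐ x ∂m, |f x| ≤ M) (hgN : ∀ᵐ x ∂m, |g x| ≤ N) :
    IsWeakUpperGradient m (fun x => f x * g x)
      (fun x => |f x| * minGrad m g x + |g x| * minGrad m f x) := by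
  have hF := hf.minGrad_wug
  have hG := hg.minGrad_wug
  have hm1 : Measurable (fun x => |f x| * minGrad m g x) :=
    (continuous_abs.measurable.comp hf.1).mul hG.measurable
  have hm2 : Measurable (fun x => |g x| * minGrad m f x) :=
    (continuous_abs.measurable.comp hg.1).mul hF.measurable
  refine .of_rep_real (hm1.add hm2) (fun x => add_nonneg (mul_nonneg (abs_nonneg _) (hG.nonneg x))
      (mul_nonneg (abs_nonneg _) (hF.nonneg x)))
    (((hG.memLp.const_mul M).mono hm1.aestronglyMeasurable ?_).add
      ((hF.memLp.const_mul N).mono hm2.aestronglyMeasurable ?_)) fun π hπ => ?_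
  · filter_upwards [hfM] with x hx
    rw [norm_mul, norm_mul, Real.norm_eq_abs, abs_abs, Real.norm_eq_abs M]
    exact mul_le_mul_of_nonneg_right (hx.trans (le_abs_self _)) (norm_nonneg _)
  · filter_upwards [hgN] with x hx
    rw [norm_mul, norm_mul, Real.norm_eq_abs, abs_abs, Real.norm_eq_abs N]
    exact mul_le_mul_of_nonneg_right (hx.trans (le_abs_self _)) (norm_nonneg _)
  · filter_upwards [hF.exists_rep_real hf.1 hπ, hG.exists_rep_real hg.1 hπ] with γ h1 h2
    obtain ⟨U, hU, hUd⟩ := h1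
    obtain ⟨V, hV, hVd⟩ := h2
    refine ⟨fun t => U t * V t, ⟨hU.aci.mul hV.aci, ?_, ?_, ?_⟩, ?_⟩
    · simp only [hU.zero, hV.zero]
    · simp only [hU.one, hV.one]
    · filter_upwards [hU.ae_eq, hV.ae_eq] with t h3 h4
      rw [h3, h4]
    · filter_upwards [hUd, hVd, hU.ae_eq, hV.ae_eq, hU.aci.ae_deriv_mul hV.aci]
        with t h3 h4 h5 h6 h7
      rw [h7, h5, h6]
      refine (abs_add_le _ _).trans ?_
      rw [abs_mul, abs_mul]
      nlinarith [abs_nonneg (f (γ t)), abs_nonneg (g (γ t))]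

theorem IsSobolev.mul (hf : IsSobolev m f) (hg : IsSobolev m g) {M N : ℝ}
    (hfM : ∀ᵐ x ∂m, |f x| ≤ M) (hgN : ∀ᵐ x ∂m, |g x| ≤ N) :
    IsSobolev m (fun x => f x * g x) :=
  (hf.mul_wug hg hfM hgN).isSobolev (hf.1.mul hg.1)

theorem IsSobolev.minGrad_mul_le (hf : IsSobolev m f) (hg : IsSobolev m g) {M N : ℝ}
    (hfM : ∀ᵐ x ∂m, |f x| ≤ M) (hgN : ∀ᵐ x ∂m, |g x| ≤ N) :
    ∀ᵐ x ∂m, minGrad m (fun x => f x * g x) x ≤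
      |f x| * minGrad m g x + |g x| * minGrad m f x :=
  (hf.mul_wug hg hfM hgN).minGrad_le (hf.1.mul hg.1)

/-- Lipschitz functions supported in a set of finite measure. -/
theorem LipschitzWith.isWeakUpperGradient {h : X → ℝ} {K : ℝ≥0} (hh : LipschitzWith K h)
    (hfin : m (Function.support h) < ∞) :
    IsWeakUpperGradient m h ((Function.support h).indicator fun _ => (K : ℝ)) := by
  have hS : MeasurableSet (Function.support h) :=
    hh.continuous.isOpen_support.measurableSet
  refine .of_rep_real (measurable_const.indicator hS)
    (fun x => indicator_nonneg (fun x _ => K.2) x)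
    (memLp_indicator_const 2 hS _ (Or.inr hfin.ne)) fun π hπ => ?_
  filter_upwards [hπ.ae_isAC2, hπ.ae_speed_lt_top] with γ h1 h2
  obtain ⟨U, hU, hUe, hUd⟩ := h1.exists_ACI hh
  refine ⟨U, ⟨hU, by simpa using hUe 0, by simpa using hUe 1, Eventually.of_forall hUe⟩, ?_⟩
  -- The null set `{0}` disposes of the times at which `h` vanishes, so the constant `K` is needed
  -- only on the support.
  filter_upwards [hUd, h2, hU.ae_deriv_eq_zero (N := {0}) (by simp)] with t h3 h4 h5
  by_cases h6 : h (γ t) = 0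
  · rw [indicator_of_notMem (by simpa using h6), h5 (by simp [hUe, h6])]
    simp
  · rw [indicator_of_mem (by simpa using h6)]
    rw [← ENNReal.ofReal_toReal h4.ne, ← ENNReal.ofReal_coe_nnreal,
      ← ENNReal.ofReal_mul K.coe_nonneg] at h3
    exact (ENNReal.ofReal_le_ofReal_iff (mul_nonneg K.2 (realSpeed_nonneg _ _))).1 h3

end Calculus

/-! ### Zigzag functions and rational approximation of constants -/

section Zigzag

/-- Take `δ` times the distance from `t / δ` to the nearest integer; its corners, the half-integer
multiples of `δ` together with the integer ones, form the countable set `N`. Composition makes a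
function uniformly small without changing its gradient. -/
theorem exists_zigzag {δ : ℝ} (hδ : 0 < δ) : ∃ z : ℝ → ℝ, LipschitzWith 1 z ∧ (∀ t, |z t| ≤ δ) ∧
    ∃ N : Set ℝ, volume N = 0 ∧ ∀ t ∉ N, deriv z t = 1 ∨ deriv z t = -1 := by
  refine ⟨fun t => δ * |t / δ - round (t / δ)|, ?_, fun t => ?_,
    (fun k : ℤ => δ * (k / 2)) '' univ, (countable_univ.image _).measure_zero _, fun t ht => ?_⟩
  · refine LipschitzWith.of_le_add_mul _ fun x y => ?_
    have h1 := round_le (x / δ) (round (y / δ))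
    have h2 : |x / δ - round (y / δ)| ≤ |x / δ - y / δ| + |y / δ - round (y / δ)| := abs_sub_le _ _ _
    have h3 : δ * |x / δ - y / δ| = dist x y := by
      rw [← sub_div, abs_div, abs_of_pos hδ, Real.dist_eq]
      field_simp
    rw [NNReal.coe_one, one_mul, ← h3, ← mul_add]
    gcongr
    linarith
  · rw [abs_mul, abs_abs, abs_of_pos hδ]
    have := abs_sub_round (t / δ)
    nlinarith
  · set k := round (t / δ) with hk
    have h1 : |t / δ - k| < 1 / 2 := by
      refine lt_of_le_of_ne (abs_sub_round _) fun h => ht ?_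
      rcases (abs_eq (by norm_num)).1 h with h | h
      · refine ⟨2 * k + 1, mem_univ _, ?_⟩
        have : t / δ = k + 1 / 2 := by linarith
        rw [div_eq_iff hδ.ne'] at this
        push_cast
        linarith
      · refine ⟨2 * k - 1, mem_univ _, ?_⟩
        have : t / δ = k - 1 / 2 := by linarith
        rw [div_eq_iff hδ.ne'] at this
        push_cast
        linarith
    have h0 : t / δ - k ≠ 0 := fun h => ht ⟨2 * k, mem_univ _, by
      rw [sub_eq_zero, div_eq_iff hδ.ne'] at h
      push_cast
      linarith⟩
    have h2 : (fun s => δ * |s / δ - round (s / δ)|) =ᶠ[𝓝 t] fun s => δ * |s / δ - k| := by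
      have h3 : ∀ᶠ s in 𝓝 t, |s / δ - k| < 1 / 2 := by
        have : Continuous fun s : ℝ => |s / δ - k| := by fun_prop
        exact this.continuousAt.eventually (gt_mem_nhds h1)
      filter_upwards [h3] with s hs
      by_cases hr : round (s / δ) = k
      · rw [hr]
      · exfalso
        have h4 := abs_sub_round (s / δ)
        have h5 : (1 : ℝ) ≤ |(round (s / δ) : ℝ) - k| := by
          exact_mod_cast Int.one_le_abs (sub_ne_zero.2 hr)
        have h6 := abs_sub_le (round (s / δ) : ℝ) (s / δ) k
        rw [abs_sub_comm (round (s / δ) : ℝ) (s / δ)] at h6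
        linarith
    rw [h2.deriv_eq]
    have h3 : HasDerivAt (fun s : ℝ => s / δ - k) (1 / δ) t := ((hasDerivAt_id t).div_const δ).sub_const _
    rcases lt_or_gt_of_ne h0 with h | h
    · right
      have := ((hasDerivAt_abs_neg h).comp t h3).const_mul δ
      refine this.deriv.trans ?_
      field_simp
    · left
      have := ((hasDerivAt_abs_pos h).comp t h3).const_mul δ
      refine this.deriv.trans ?_
      field_simp

/-- Estimates known a.e. for each fixed constant are imposed for rational constants only, at the
cost of one null set; continuity then permits a constant depending on the point. -/
theorem le_of_forall_rat_le {F G : ℝ → ℝ} (hF : Continuous F) (hG : Continuous G)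
    (h : ∀ q : ℚ, F q ≤ G q) (c : ℝ) : F c ≤ G c :=
  Rat.denseRange_cast.induction_on (p := fun c => F c ≤ G c) c (isClosed_le hF hG) h

end Zigzag

/-! ### Gradient norms and their behaviour under zigzags -/

section Parallelogram

variable {X : Type*} [MetricSpace X] [MeasurableSpace X] [BorelSpace X]
  [SecondCountableTopology X] {m : Measure X} {f g : X → ℝ}

theorem IsSobolev.add (hf : IsSobolev m f) (hg : IsSobolev m g) :
    IsSobolev m (fun x => f x + g x) := by
  simpa using hf.linear hg 1 1

theorem IsSobolev.sub (hf : IsSobolev m f) (hg : IsSobolev m g) :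
    IsSobolev m (fun x => f x - g x) := by
  simpa [sub_eq_add_neg] using hf.linear hg 1 (-1)

theorem IsSobolev.const_mul (hf : IsSobolev m f) (c : ℝ) : IsSobolev m (fun x => c * f x) := by
  simpa using hf.linear hf c 0

theorem IsSobolev.minGrad_add_le (hf : IsSobolev m f) (hg : IsSobolev m g) :
    ∀ᵐ x ∂m, minGrad m (fun x => f x + g x) x ≤ minGrad m f x + minGrad m g x := by
  simpa using hf.minGrad_linear_le hg 1 1

theorem IsSobolev.minGrad_sub_le (hf : IsSobolev m f) (hg : IsSobolev m g) :
    ∀ᵐ x ∂m, minGrad m (fun x => f x - g x) x ≤ minGrad m f x + minGrad m g x := by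
  simpa [sub_eq_add_neg] using hf.minGrad_linear_le hg 1 (-1)

theorem IsSobolev.minGrad_const_mul (hf : IsSobolev m f) (c : ℝ) :
    ∀ᵐ x ∂m, minGrad m (fun x => c * f x) x = |c| * minGrad m f x := by
  have key : ∀ {f : X → ℝ}, IsSobolev m f → ∀ c : ℝ,
      ∀ᵐ x ∂m, minGrad m (fun x => c * f x) x ≤ |c| * minGrad m f x := by
    intro f hf c
    simpa using hf.minGrad_linear_le hf c 0
  by_cases hc : c = 0
  · filter_upwards [key hf c] with x hx
    refine le_antisymm hx ?_
    rw [hc, abs_zero, zero_mul]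
    exact minGrad_nonneg _ _ _
  · have h1 := key (hf.const_mul c) c⁻¹
    have h2 : (fun x => c⁻¹ * (c * f x)) = f := by ext x; field_simp
    rw [h2] at h1
    filter_upwards [key hf c, h1] with x h3 h4
    refine le_antisymm h3 ?_
    rw [abs_inv, inv_mul_eq_div, le_div_iff₀ (abs_pos.2 hc)] at h4
    linarith

theorem IsSobolev.abs_minGrad_sub_le (hf : IsSobolev m f) (hg : IsSobolev m g) :
    ∀ᵐ x ∂m, |minGrad m f x - minGrad m g x| ≤ minGrad m (fun x => f x - g x) x := by
  have h1 := (hf.sub hg).minGrad_add_le hg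
  have h2 := hf.minGrad_sub_le (hf.sub hg)
  have e1 : (fun x => f x - g x + g x) = f := by ext x; ring
  have e2 : (fun x => f x - (f x - g x)) = g := by ext x; ring
  rw [e1] at h1
  rw [e2] at h2
  filter_upwards [h1, h2] with x h3 h4
  rw [abs_le]
  constructor <;> linarith

theorem IsSobolev.integrable_minGrad_sq (hf : IsSobolev m f) :
    Integrable (fun x => minGrad m f x ^ 2) m := hf.minGrad_wug.integrable_sq

/-- Multiplying by a zigzag changes the gradient at most by a sign. -/
theorem IsSobolev.minGrad_zigzag (hf : IsSobolev m f) {z : ℝ → ℝ} (hz : LipschitzWith 1 z)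
    {N : Set ℝ} (hN : volume N = 0) (hzd : ∀ t ∉ N, deriv z t = 1 ∨ deriv z t = -1) :
    ∀ᵐ x ∂m, minGrad m (fun x => z (f x) - 1 * f x) x = 0 ∨
      minGrad m (fun x => z (f x) - -1 * f x) x = 0 := by
  -- The function `z t - ε * t` has zero derivative wherever `z' = ε`, so the chain inequality kills
  -- its gradient for the appropriate sign `ε`.
  have hl : ∀ ε : ℝ, ∃ K, LipschitzWith K fun t => z t - ε * t := fun ε => by
    exact ⟨1 + ‖ε‖₊, hz.sub (lipschitzWith_smul ε)⟩
  obtain ⟨K1, h1⟩ := hl 1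
  obtain ⟨K2, h2⟩ := hl (-1)
  filter_upwards [hf.minGrad_comp_le h1, hf.minGrad_comp_le h2, hf.minGrad_eq_zero_of_mem_null hN]
    with x h3 h4 h5
  by_cases hx : f x ∈ N
  · rw [h5 hx, mul_zero] at h3
    exact Or.inl (le_antisymm h3 (minGrad_nonneg _ _ _))
  have hd : ∀ ε : ℝ, deriv z (f x) = ε → ε ≠ 0 → deriv (fun t => z t - ε * t) (f x) = 0 := by
    intro ε h h0
    have hdz : DifferentiableAt ℝ z (f x) := by
      by_contra hn
      rw [deriv_zero_of_not_differentiableAt hn] at h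
      exact h0 h.symm
    rw [deriv_fun_sub hdz (by fun_prop), h]
    simp
  rcases hzd _ hx with h | h
  · left
    rw [hd 1 h one_ne_zero, abs_zero, zero_mul] at h3
    exact le_antisymm h3 (minGrad_nonneg _ _ _)
  · right
    rw [hd (-1) h (by norm_num), abs_zero, zero_mul] at h4
    exact le_antisymm h4 (minGrad_nonneg _ _ _)

/-- By the reverse triangle inequality, changes with zero gradient at `x` do not affect the gradient
at `x`. This allows `z(f)` and `z(g)` to be replaced by `±f` and `±g`, with signs depending on the
point. -/
theorem minGrad_linear_congr {f' g' : X → ℝ} (hf : IsSobolev m f) (hg : IsSobolev m g)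
    (hf' : IsSobolev m f') (hg' : IsSobolev m g') (α β ε ε' : ℝ) :
    ∀ᵐ x ∂m, minGrad m (fun x => f' x - ε * f x) x = 0 →
      minGrad m (fun x => g' x - ε' * g x) x = 0 →
      minGrad m (fun x => α * f' x + β * g' x) x =
        minGrad m (fun x => (α * ε) * f x + (β * ε') * g x) x := by
  have h1 := (hf'.linear hg' α β).abs_minGrad_sub_le (hf.linear hg (α * ε) (β * ε'))
  have h2 := (hf'.sub (hf.const_mul ε)).minGrad_linear_le (hg'.sub (hg.const_mul ε')) α β
  have e : (fun x => α * f' x + β * g' x - (α * ε * f x + β * ε' * g x)) =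
      fun x => α * (f' x - ε * f x) + β * (g' x - ε' * g x) := by ext x; ring
  rw [e] at h1
  filter_upwards [h1, h2] with x h3 h4 h5 h6
  rw [h5, h6, mul_zero, mul_zero, add_zero] at h4
  exact sub_eq_zero.1 (abs_nonpos_iff.1 (h3.trans h4))

theorem minGrad_neg (hf : IsSobolev m f) :
    ∀ᵐ x ∂m, minGrad m (fun x => - f x) x = minGrad m f x := by
  simpa using hf.minGrad_const_mul (-1)

/-- The norms entering the parallelogram identity are invariant under zigzags. -/
theorem parallelogram_zigzag (hf : IsSobolev m f) (hg : IsSobolev m g) {z : ℝ → ℝ}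
    (hz : LipschitzWith 1 z) {N : Set ℝ} (hN : volume N = 0)
    (hzd : ∀ t ∉ N, deriv z t = 1 ∨ deriv z t = -1) :
    ∀ᵐ x ∂m, minGrad m (fun x => z (f x)) x = minGrad m f x ∧
      minGrad m (fun x => z (g x)) x = minGrad m g x ∧
      minGrad m (fun x => z (f x) + z (g x)) x ^ 2 + minGrad m (fun x => z (f x) - z (g x)) x ^ 2 =
        minGrad m (fun x => f x + g x) x ^ 2 + minGrad m (fun x => f x - g x) x ^ 2 := by
  have hzf := hf.comp hz
  have hzg := hg.comp hz
  have hA : ∀ α β ε ε' : ℝ, _ := fun α β ε ε' => minGrad_linear_congr hf hg hzf hzg α β ε ε'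
  have s1 := minGrad_neg hf
  have s2 := minGrad_neg hg
  have s3 := minGrad_neg (hf.add hg)
  have s4 := minGrad_neg (hf.sub hg)
  have e1 : (fun x => -(f x + g x)) = fun x => - f x - g x := by ext x; ring
  have e2 : (fun x => -(f x - g x)) = fun x => - f x + g x := by ext x; ring
  rw [e1] at s3
  rw [e2] at s4
  filter_upwards [hf.minGrad_zigzag hz hN hzd, hg.minGrad_zigzag hz hN hzd, s1, s2, s3, s4,
    hA 1 0 1 1, hA 1 0 (-1) 1, hA 1 0 1 (-1), hA 1 0 (-1) (-1),
    hA 0 1 1 1, hA 0 1 (-1) 1, hA 0 1 1 (-1), hA 0 1 (-1) (-1),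
    hA 1 1 1 1, hA 1 1 (-1) 1, hA 1 1 1 (-1), hA 1 1 (-1) (-1),
    hA 1 (-1) 1 1, hA 1 (-1) (-1) 1, hA 1 (-1) 1 (-1), hA 1 (-1) (-1) (-1)]
    with x hu hv s1 s2 s3 s4 a1 a2 a3 a4 b1 b2 b3 b4 c1 c2 c3 c4 d1 d2 d3 d4
  -- If the two signs agree, sum and difference are kept up to a common sign; if they differ, sum
  -- and difference trade places up to sign. The sum of the two squares is the same in all cases.
  rcases hu with hu | hu <;> rcases hv with hv | hv
  · have a := a1 hu hv; have b := b1 hu hv; have c := c1 hu hv; have d := d1 hu hv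
    simp [← sub_eq_add_neg] at a b c d
    rw [a, b, c, d]; simp
  · have a := a3 hu hv; have b := b3 hu hv; have c := c3 hu hv; have d := d3 hu hv
    simp [← sub_eq_add_neg] at a b c d
    rw [a, b, c, d, s2]; simp [add_comm]
  · have a := a2 hu hv; have b := b2 hu hv; have c := c2 hu hv; have d := d2 hu hv
    simp [← sub_eq_add_neg] at a b c d
    rw [a, b, c, d, s1, s3, s4]; simp [add_comm]
  · have a := a4 hu hv; have b := b4 hu hv; have c := c4 hu hv; have d := d4 hu hv
    simp [← sub_eq_add_neg] at a b c d
    rw [a, b, c, d, s1, s2, s3, s4]; simp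

end Parallelogram

/-! ### From the integrated to the pointwise parallelogram identity -/

section Pointwise

variable {X : Type*} [MetricSpace X] [MeasurableSpace X] [BorelSpace X]
  [SecondCountableTopology X] {m : Measure X} {f g : X → ℝ}

/-- Freeze the coefficient: `h w - c w = (h - c) w`, to which the Leibniz inequality applies.
Choosing `c = h x`, through rational `c`, leaves only `|w| |Dh|`. -/
theorem IsSobolev.abs_minGrad_mul_sub_le {h w : X → ℝ} (hh : IsSobolev m h) (hw : IsSobolev m w)
    {M N : ℝ} (hM : ∀ᵐ x ∂m, |h x| ≤ M) (hN : ∀ᵐ x ∂m, |w x| ≤ N) :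
    ∀ᵐ x ∂m, |minGrad m (fun x => h x * w x) x - |h x| * minGrad m w x| ≤
      |w x| * minGrad m h x := by
  have hhw := hh.mul hw hM hN
  have key : ∀ c : ℝ, ∀ᵐ x ∂m, |minGrad m (fun x => h x * w x) x - |c| * minGrad m w x| ≤
      |h x - c| * minGrad m w x + |w x| * minGrad m h x := by
    intro c
    have hφ : LipschitzWith 1 (fun t : ℝ => t - c) := LipschitzWith.of_dist_le_mul fun x y => by simp
    have hc := hh.comp hφ
    have hcM : ∀ᵐ x ∂m, |h x - c| ≤ M + |c| := by
      filter_upwards [hM] with x hx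
      exact (abs_sub _ _).trans (by linarith)
    have h1 := hhw.abs_minGrad_sub_le (hw.const_mul c)
    have h2 := hc.minGrad_mul_le hw hcM hN
    have e : (fun x => h x * w x - c * w x) = fun x => (h x - c) * w x := by ext x; ring
    rw [e] at h1
    filter_upwards [h1, h2, hw.minGrad_const_mul c, hh.minGrad_comp_le hφ] with x h3 h4 h5 h6
    rw [h5] at h3
    have h7 : minGrad m (fun x => h x - c) x ≤ minGrad m h x := by
      have : |deriv (fun t : ℝ => t - c) (h x)| ≤ 1 := by simp
      refine h6.trans ?_
      nlinarith [minGrad_nonneg m h x]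
    refine h3.trans (h4.trans ?_)
    gcongr
  filter_upwards [ae_all_iff.2 fun q : ℚ => key q] with x hx
  have := le_of_forall_rat_le (F := fun c => |minGrad m (fun x => h x * w x) x - |c| * minGrad m w x|)
    (G := fun c => |h x - c| * minGrad m w x + |w x| * minGrad m h x) (by fun_prop) (by fun_prop)
    hx (h x)
  simpa using this

/-- The defect in the pointwise parallelogram identity. -/
def parallelogramDefect (m : Measure X) (f g : X → ℝ) (x : X) : ℝ :=
  minGrad m (fun x => f x + g x) x ^ 2 + minGrad m (fun x => f x - g x) x ^ 2 -
    2 * minGrad m f x ^ 2 - 2 * minGrad m g x ^ 2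

theorem IsSobolev.integrable_parallelogramDefect (hf : IsSobolev m f) (hg : IsSobolev m g) :
    Integrable (parallelogramDefect m f g) m :=
  (((hf.add hg).integrable_minGrad_sq.add (hf.sub hg).integrable_minGrad_sq).sub
    (hf.integrable_minGrad_sq.const_mul 2)).sub (hg.integrable_minGrad_sq.const_mul 2)

theorem InfinitesimallyHilbertian.integral_parallelogramDefect (hm : InfinitesimallyHilbertian m)
    (hf : IsSobolev m f) (hg : IsSobolev m g) : ∫ x, parallelogramDefect m f g x ∂m = 0 := by
  have h1 := (hf.add hg).integrable_minGrad_sq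
  have h2 := (hf.sub hg).integrable_minGrad_sq
  have h3 := hf.integrable_minGrad_sq.const_mul 2
  have h4 := hg.integrable_minGrad_sq.const_mul 2
  unfold parallelogramDefect
  have h := hm f g hf hg
  change (∫ x, minGrad m (fun x => f x + g x) x ^ 2 ∂m) +
    (∫ x, minGrad m (fun x => f x - g x) x ^ 2 ∂m) = _ at h
  have i1 := integral_sub ((h1.add h2).sub h3) h4
  have i2 := integral_sub (h1.add h2) h3
  have i3 := integral_add h1 h2
  simp only [Pi.add_apply, Pi.sub_apply] at i1 i2 i3
  rw [i1, i2, i3, integral_const_mul, integral_const_mul, h]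
  ring

theorem abs_sq_sub_sq_le {a b e B : ℝ} (h : |a - b| ≤ e) (hb : 0 ≤ b) (hB : b ≤ B) :
    |a ^ 2 - b ^ 2| ≤ e * (2 * B + e) := by
  have he : 0 ≤ e := (abs_nonneg _).trans h
  have h1 : a ^ 2 - b ^ 2 = (a - b) * (2 * b + (a - b)) := by ring
  rw [h1, abs_mul]
  gcongr
  refine (abs_add_le _ _).trans ?_
  rw [abs_of_nonneg (by linarith)]
  linarith

/-- The four errors enter the defect with weights `1, 1, 2, 2`, whence `6`. -/
theorem abs_defect_sub_le {H a b p q A B P Q P' Q' T : ℝ} (hc : P' + Q' = P + Q)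
    (ha : |a - H * A| ≤ T) (hb : |b - H * B| ≤ T) (hp : |p - H * P'| ≤ T) (hq : |q - H * Q'| ≤ T) :
    |H * (P + Q - 2 * A - 2 * B) - (p + q - 2 * a - 2 * b)| ≤ 6 * T := by
  have h1 : H * (P + Q - 2 * A - 2 * B) = H * P' + H * Q' - 2 * (H * A) - 2 * (H * B) := by
    rw [← hc]; ring
  rw [h1]
  rw [abs_le] at *
  constructor <;> linarith

/-- The pair `h z(f)`, `h z(g)` has a defect with zero integral. Since `|z| ≤ δ`, its gradients
differ from `|h|` times those of `z(f)`, `z(g)` and their sum and difference by `O(δ)`, and zigzag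
invariance identifies the resulting defect with `h²` times that of `f, g`. Let `δ → 0`. -/
theorem InfinitesimallyHilbertian.integral_sq_mul_defect (hm : InfinitesimallyHilbertian m)
    (hf : IsSobolev m f) (hg : IsSobolev m g) {h : X → ℝ} {K : ℝ≥0} (hh : LipschitzWith K h)
    {M : ℝ} (hM : ∀ x, |h x| ≤ M) (hfin : m (Function.support h) < ∞) :
    ∫ x, h x ^ 2 * parallelogramDefect m f g x ∂m = 0 := by
  have hW := LipschitzWith.isWeakUpperGradient hh hfin
  have hhm : Measurable h := hh.continuous.measurable
  have hS := hW.isSobolev hhm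
  have hM' : ∀ᵐ x ∂m, |h x| ≤ M := Eventually.of_forall hM
  set s : X → ℝ := (Function.support h).indicator fun _ => (K : ℝ) with hs
  have hs0 : ∀ x, 0 ≤ s x := hW.nonneg
  -- Integrable as a product of two `L²` functions. The factor `12` is the `6` of
  -- `abs_defect_sub_le` times the `2` in the common bound `2 * δ` for `z(f)`, `z(g)`, their sum and
  -- their difference.
  set Θ : X → ℝ := fun x => 12 * s x * (2 * (M * (minGrad m f x + minGrad m g x)) + 2 * s x) with hΘ
  have hΘi : Integrable Θ m := by
    have h1 : MemLp (fun x => 2 * (M * (minGrad m f x + minGrad m g x)) + 2 * s x) 2 m :=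
      (((hf.minGrad_wug.memLp.add hg.minGrad_wug.memLp).const_mul M).const_mul 2).add
        (hW.memLp.const_mul 2)
    have h2 := (hW.memLp.const_mul 12).integrable_mul h1
    exact h2
  have hd : ∀ δ : ℝ, 0 < δ → δ ≤ 1 →
      |∫ x, h x ^ 2 * parallelogramDefect m f g x ∂m| ≤ δ * ∫ x, Θ x ∂m := by
    intro δ hδ hδ1
    obtain ⟨z, hz, hzδ, N, hN, hzd⟩ := exists_zigzag hδ
    have hzf := hf.comp hz
    have hzg := hg.comp hz
    have b1 : ∀ᵐ x ∂m, |z (f x)| ≤ 2 * δ := Eventually.of_forall fun x => by linarith [hzδ (f x)]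
    have b2 : ∀ᵐ x ∂m, |z (g x)| ≤ 2 * δ := Eventually.of_forall fun x => by linarith [hzδ (g x)]
    have b3 : ∀ᵐ x ∂m, |z (f x) + z (g x)| ≤ 2 * δ := Eventually.of_forall fun x => by
      linarith [hzδ (f x), hzδ (g x), abs_add_le (z (f x)) (z (g x))]
    have b4 : ∀ᵐ x ∂m, |z (f x) - z (g x)| ≤ 2 * δ := Eventually.of_forall fun x => by
      linarith [hzδ (f x), hzδ (g x), abs_sub (z (f x)) (z (g x))]
    have hp := hS.mul hzf hM' b1
    have hq := hS.mul hzg hM' b2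
    have hI := hm.integral_parallelogramDefect hp hq
    have hDi := hp.integrable_parallelogramDefect hq
    have hFi : Integrable (fun x => h x ^ 2 * parallelogramDefect m f g x) m := by
      refine (hf.integrable_parallelogramDefect hg).bdd_mul (c := M ^ 2)
        (hhm.pow_const 2).aestronglyMeasurable (Eventually.of_forall fun x => ?_)
      rw [norm_pow, Real.norm_eq_abs]
      exact pow_le_pow_left₀ (abs_nonneg _) (hM x) 2
    have hle : ∀ᵐ x ∂m, |h x ^ 2 * parallelogramDefect m f g x -
        parallelogramDefect m (fun x => h x * z (f x)) (fun x => h x * z (g x)) x| ≤ δ * Θ x := by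
      have e1 : (fun x => h x * z (f x) + h x * z (g x)) =
        fun x => h x * (z (f x) + z (g x)) := by ext x; ring
      have e2 : (fun x => h x * z (f x) - h x * z (g x)) =
        fun x => h x * (z (f x) - z (g x)) := by ext x; ring
      simp only [parallelogramDefect, e1, e2]
      filter_upwards [hS.abs_minGrad_mul_sub_le hzf hM' b1, hS.abs_minGrad_mul_sub_le hzg hM' b2,
        hS.abs_minGrad_mul_sub_le (hzf.add hzg) hM' b3, hS.abs_minGrad_mul_sub_le (hzf.sub hzg) hM' b4,
        parallelogram_zigzag hf hg hz hN hzd, hW.minGrad_le hhm, b1, b2, b3, b4,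
        hzf.minGrad_add_le hzg, hzf.minGrad_sub_le hzg]
        with x c1 c2 c3 c4 c5 c6 b1 b2 b3 b4 c7 c8
      obtain ⟨c9, c10, c11⟩ := c5
      have hsx := hs0 x
      have hhx : |h x| ≤ M := hM x
      have hDf := minGrad_nonneg m f x
      have hDg := minGrad_nonneg m g x
      have hM0 : 0 ≤ M := (abs_nonneg _).trans hhx
      have E : ∀ w : X → ℝ, |w x| ≤ 2 * δ →
          |minGrad m (fun x => h x * w x) x - |h x| * minGrad m w x| ≤ |w x| * minGrad m h x →
          minGrad m w x ≤ minGrad m f x + minGrad m g x →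
          |minGrad m (fun x => h x * w x) x ^ 2 - h x ^ 2 * minGrad m w x ^ 2| ≤
            δ * (2 * s x * (2 * (M * (minGrad m f x + minGrad m g x)) + 2 * s x)) := by
        intro w hw1 hw2 hw3
        have hw4 : |minGrad m (fun x => h x * w x) x - |h x| * minGrad m w x| ≤ 2 * δ * s x :=
          hw2.trans (mul_le_mul hw1 c6 (minGrad_nonneg _ _ _) (by positivity))
        have hw5 := abs_sq_sub_sq_le hw4 (mul_nonneg (abs_nonneg _) (minGrad_nonneg _ _ _))
          (B := M * (minGrad m f x + minGrad m g x))
          (mul_le_mul hhx hw3 (minGrad_nonneg _ _ _) hM0)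
        rw [mul_pow, sq_abs] at hw5
        refine hw5.trans ?_
        have : 2 * δ * s x ≤ 2 * s x := by nlinarith
        calc 2 * δ * s x * (2 * (M * (minGrad m f x + minGrad m g x)) + 2 * δ * s x)
            ≤ 2 * δ * s x * (2 * (M * (minGrad m f x + minGrad m g x)) + 2 * s x) := by gcongr
          _ = _ := by ring
      have E1 := E _ b1 c1 (by rw [c9]; linarith)
      have E2 := E _ b2 c2 (by rw [c10]; linarith)
      have E3 := E _ b3 c3 (by rw [← c9, ← c10]; exact c7)
      have E4 := E _ b4 c4 (by rw [← c9, ← c10]; exact c8)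
      have hΘx : δ * Θ x = 6 * (δ * (2 * s x * (2 * (M * (minGrad m f x + minGrad m g x)) + 2 * s x))) := by
        rw [hΘ]; ring
      rw [hΘx]
      rw [c9] at E1
      rw [c10] at E2
      exact abs_defect_sub_le c11 E1 E2 E3 E4
    have h1 : ∫ x, h x ^ 2 * parallelogramDefect m f g x ∂m = ∫ x, (h x ^ 2 * parallelogramDefect m f g x -
        parallelogramDefect m (fun x => h x * z (f x)) (fun x => h x * z (g x)) x) ∂m := by
      rw [integral_sub hFi hDi, hI, sub_zero]
    rw [h1, ← integral_const_mul]
    refine (abs_integral_le_integral_abs).trans (integral_mono_ae (hFi.sub hDi).abs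
      (hΘi.const_mul δ) hle)
  have hlim : Tendsto (fun n : ℕ => 1 / ((n : ℝ) + 1) * ∫ x, Θ x ∂m) atTop (𝓝 0) := by
    simpa using tendsto_one_div_add_atTop_nhds_zero_nat.mul_const (∫ x, Θ x ∂m)
  refine abs_nonpos_iff.1 (ge_of_tendsto' hlim fun n => hd _ (by positivity) ?_)
  rw [div_le_one (by positivity)]
  linarith [n.cast_nonneg (α := ℝ)]

/-- The squares of the cutoffs `min 1 (k * infDist x Uᶜ)` converge to the indicator of `U`, with
`|F|` as dominating function. -/
theorem setIntegral_isOpen_eq_zero {F : X → ℝ} (hF : Integrable F m)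
    (h0 : ∀ (h : X → ℝ) (K : ℝ≥0), LipschitzWith K h → (∀ x, |h x| ≤ 1) →
      m (Function.support h) < ∞ → ∫ x, h x ^ 2 * F x ∂m = 0)
    {U : Set X} (hU : IsOpen U) (hfin : m U < ∞) : ∫ x in U, F x ∂m = 0 := by
  -- `Metric.infDist` to the empty set is `0`, so these cutoffs fail when `U` is the whole space;
  -- there the constant `1` is admissible.
  rcases (Uᶜ).eq_empty_or_nonempty with he | hne
  · have := h0 (fun _ => 1) 0 (LipschitzWith.const 1) (by simp) (by
      rw [Function.support_const one_ne_zero, ← compl_empty, ← he, compl_compl]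
      exact hfin)
    rw [compl_empty_iff.1 he]
    simpa using this
  let h : ℕ → X → ℝ := fun k x => min 1 (k * Metric.infDist x Uᶜ)
  have hL : ∀ k : ℕ, LipschitzWith k (h k) := by
    intro k
    refine LipschitzWith.const_min ?_ 1
    refine LipschitzWith.of_dist_le_mul fun x y => ?_
    have := (Metric.lipschitz_infDist_pt Uᶜ).dist_le_mul x y
    rw [Real.dist_eq, ← mul_sub, abs_mul, ← Real.dist_eq, Nat.abs_cast]
    simp only [NNReal.coe_one, one_mul] at this
    simp only [NNReal.coe_natCast]
    gcongr
  have hb0 : ∀ k x, 0 ≤ h k x := fun k x =>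
    le_min zero_le_one (mul_nonneg k.cast_nonneg Metric.infDist_nonneg)
  have hb : ∀ k x, |h k x| ≤ 1 := fun k x => by
    rw [abs_of_nonneg (hb0 k x)]; exact min_le_left _ _
  have hout : ∀ k, ∀ x ∉ U, h k x = 0 := fun k x hx => by
    simp [h, Metric.infDist_zero_of_mem (show x ∈ Uᶜ from hx)]
  have hz : ∀ k, ∫ x, h k x ^ 2 * F x ∂m = 0 := fun k => h0 _ _ (hL k) (hb k) <|
    (measure_mono (Function.support_subset_iff'.2 (hout k))).trans_lt hfin
  have hlim : Tendsto (fun k => ∫ x, h k x ^ 2 * F x ∂m) atTop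
      (𝓝 (∫ x, U.indicator F x ∂m)) := by
    refine tendsto_integral_of_dominated_convergence (fun x => |F x|) (fun k => ?_) hF.abs
      (fun k => Eventually.of_forall fun x => ?_) (Eventually.of_forall fun x => ?_)
    · exact ((hL k).continuous.measurable.pow_const 2).aestronglyMeasurable.mul hF.1
    · rw [norm_mul, norm_pow, Real.norm_eq_abs, Real.norm_eq_abs]
      exact mul_le_of_le_one_left (abs_nonneg _) (pow_le_one₀ (abs_nonneg _) (hb k x))
    · by_cases hx : x ∈ U
      · rw [indicator_of_mem hx]
        have hpos : 0 < Metric.infDist x Uᶜ :=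
          (hU.isClosed_compl.notMem_iff_infDist_pos hne).1 (by simpa using hx)
        obtain ⟨n, hn⟩ := exists_nat_gt (1 / Metric.infDist x Uᶜ)
        refine tendsto_const_nhds.congr' ?_
        filter_upwards [eventually_ge_atTop n] with k hk
        have : 1 ≤ k * Metric.infDist x Uᶜ := by
          rw [div_lt_iff₀ hpos] at hn
          have : (n : ℝ) ≤ k := by exact_mod_cast hk
          nlinarith
        simp [h, min_eq_left this]
      · rw [indicator_of_notMem hx]
        simp [hout _ x hx]
  rw [integral_indicator hU.measurableSet] at hlim
  simp only [hz] at hlim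
  exact (tendsto_nhds_unique hlim tendsto_const_nhds)

/-- A property holds almost everywhere on a set if it does so near each of its points. -/
theorem ae_of_locally {S : Set X} {p : X → Prop}
    (h : ∀ x ∈ S, ∃ U ∈ 𝓝 x, ∀ᵐ y ∂m, y ∈ U → p y) : ∀ᵐ y ∂m, y ∈ S → p y := by
  have : m {y | ¬ (y ∈ S → p y)} = 0 := by
    refine measure_null_of_locally_null _ fun x hx => ?_
    simp only [mem_ofPred_eq, Classical.not_imp] at hx
    obtain ⟨U, hU, hp⟩ := h x hx.1
    refine ⟨_, inter_mem_nhdsWithin _ hU, measure_mono_null ?_ (ae_iff.1 hp)⟩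
    rintro y ⟨hy1, hy2⟩
    simp only [mem_ofPred_eq, Classical.not_imp] at hy1 ⊢
    exact ⟨hy2, hy1.2⟩
  exact ae_iff.2 this

/-- Inside an open `B` of finite measure, the defect has zero integral over `B` and over `B` minus a
closed set, hence over the closed part. So it vanishes a.e. on `B`, and such sets cover the space.
-/
theorem InfinitesimallyHilbertian.parallelogram [IsLocallyFiniteMeasure m]
    (hm : InfinitesimallyHilbertian m) (hf : IsSobolev m f) (hg : IsSobolev m g) :
    ∀ᵐ x ∂m, minGrad m (fun x => f x + g x) x ^ 2 + minGrad m (fun x => f x - g x) x ^ 2 =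
      2 * (minGrad m f x ^ 2 + minGrad m g x ^ 2) := by
  set F := parallelogramDefect m f g
  have hF : Integrable F m := hf.integrable_parallelogramDefect hg
  have hopen : ∀ {U : Set X}, IsOpen U → m U < ∞ → ∫ x in U, F x ∂m = 0 := fun hU hfin =>
    setIntegral_isOpen_eq_zero hF (fun h K hh hM hs => hm.integral_sq_mul_defect hf hg hh hM hs)
      hU hfin
  have hae : ∀ᵐ x ∂m, x ∈ (univ : Set X) → F x = 0 := by
    refine ae_of_locally fun x _ => ?_
    obtain ⟨B, hxB, hB, hBfin⟩ := m.exists_isOpen_measure_lt_top x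
    refine ⟨B, hB.mem_nhds hxB, ?_⟩
    rw [← ae_restrict_iff' hB.measurableSet]
    refine ae_eq_zero_of_forall_setIntegral_isClosed_eq_zero hF.restrict fun C hC => ?_
    rw [Measure.restrict_restrict hC.measurableSet]
    have h1 := integral_inter_add_sdiff (s := B) (t := C) hC.measurableSet hF.integrableOn
    rw [hopen hB hBfin, sdiff_eq, hopen (hB.inter hC.isOpen_compl)
      ((measure_mono inter_subset_left).trans_lt hBfin), add_zero] at h1
    rwa [inter_comm]
  filter_upwards [hae] with x hx
  have h1 : minGrad m (fun x => f x + g x) x ^ 2 + minGrad m (fun x => f x - g x) x ^ 2 -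
    2 * minGrad m f x ^ 2 - 2 * minGrad m g x ^ 2 = 0 := hx (mem_univ x)
  linarith

end Pointwise

/-! ### Jordan–von Neumann up to null sets -/

section Bilinear

variable {α V : Type*} [MeasurableSpace α] {μ : Measure α} [AddCommGroup V] [Module ℝ V]

/-- A seminorm with values in functions which satisfies the parallelogram identity, all up to null
sets. -/
structure IsPointwiseHilbertNorm (μ : Measure α) (N : V → α → ℝ) : Prop where
  nonneg : ∀ f x, 0 ≤ N f x
  add_le : ∀ f g, ∀ᵐ x ∂μ, N (f + g) x ≤ N f x + N g x
  smul : ∀ (c : ℝ) f, ∀ᵐ x ∂μ, N (c • f) x = |c| * N f x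
  parallelogram : ∀ f g, ∀ᵐ x ∂μ, N (f + g) x ^ 2 + N (f - g) x ^ 2 = 2 * (N f x ^ 2 + N g x ^ 2)

/-- The polarisation of the square of `N`. -/
def polar (N : V → α → ℝ) (f g : V) (x : α) : ℝ := (N (f + g) x ^ 2 - N (f - g) x ^ 2) / 4

namespace IsPointwiseHilbertNorm

variable {N : V → α → ℝ}

theorem neg (h : IsPointwiseHilbertNorm μ N) (f : V) : ∀ᵐ x ∂μ, N (-f) x = N f x := by
  simpa using h.smul (-1) f

theorem polar_symm (h : IsPointwiseHilbertNorm μ N) (f g : V) :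
    ∀ᵐ x ∂μ, polar N f g x = polar N g f x := by
  filter_upwards [h.neg (f - g)] with x hx
  rw [polar, polar, add_comm g f, ← hx, neg_sub]

theorem polar_self (h : IsPointwiseHilbertNorm μ N) (f : V) :
    ∀ᵐ x ∂μ, polar N f f x = N f x ^ 2 := by
  filter_upwards [h.smul 2 f, h.smul 0 f] with x h1 h2
  rw [two_smul] at h1
  rw [zero_smul] at h2
  rw [polar, sub_self, h1, h2]
  norm_num
  ring

/-- The triangle inequality and evenness place `N (f ± g) ^ 2` between `(N f - N g) ^ 2` and `(N f +
N g) ^ 2`, which differ by `4 * N f * N g`. -/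
theorem abs_polar_le (h : IsPointwiseHilbertNorm μ N) (f g : V) :
    ∀ᵐ x ∂μ, |polar N f g x| ≤ N f x * N g x := by
  have h1 := h.add_le (f - g) g
  have h2 := h.add_le f (-g)
  have h3 := h.add_le (f + g) (-g)
  have h4 := h.add_le (f + g) (-f)
  have h5 := h.add_le (-(f - g)) f
  rw [sub_add_cancel] at h1
  rw [← sub_eq_add_neg] at h2
  rw [add_neg_cancel_right] at h3
  rw [add_neg_cancel_comm] at h4
  rw [neg_sub, sub_add_cancel] at h5
  filter_upwards [h1, h2, h3, h4, h5, h.add_le f g, h.neg f, h.neg g, h.neg (f - g)]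
    with x h1 h2 h3 h4 h5 h6 h7 h8 h9
  rw [neg_sub] at h9
  have p1 := h.nonneg (f + g) x
  have p2 := h.nonneg (f - g) x
  have p3 := h.nonneg f x
  have p4 := h.nonneg g x
  rw [h8] at h2 h3
  rw [h7] at h4
  rw [h9] at h5
  rw [polar, abs_le]
  have hs : |N f x - N g x| ≤ N (f + g) x := abs_le.2 ⟨by linarith, by linarith⟩
  have hd : |N f x - N g x| ≤ N (f - g) x := abs_le.2 ⟨by linarith, by linarith⟩
  have a1 := pow_le_pow_left₀ (abs_nonneg _) hs 2
  have a2 := pow_le_pow_left₀ (abs_nonneg _) hd 2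
  have a3 := pow_le_pow_left₀ p1 h6 2
  have a4 := pow_le_pow_left₀ p2 h2 2
  rw [sq_abs] at a1 a2
  constructor <;> linarith

theorem polar_neg_left (h : IsPointwiseHilbertNorm μ N) (f g : V) :
    ∀ᵐ x ∂μ, polar N (-f) g x = - polar N f g x := by
  filter_upwards [h.neg (f - g), h.neg (f + g)] with x h1 h2
  rw [neg_sub] at h1
  rw [neg_add'] at h2
  rw [polar, polar, h2, neg_add_eq_sub, h1]
  ring

/-- Subtracting the parallelogram identities for `f₁ ± g` and `f₂` gives `key`. Adding the version
with `f₁`, `f₂` exchanged cancels the terms in `f₁ - f₂`, by oddness. -/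
theorem polar_add_left (h : IsPointwiseHilbertNorm μ N) (f₁ f₂ g : V) :
    ∀ᵐ x ∂μ, polar N (f₁ + f₂) g x = polar N f₁ g x + polar N f₂ g x := by
  have key : ∀ f₁ f₂ : V, ∀ᵐ x ∂μ, polar N (f₁ + f₂) g x + polar N (f₁ - f₂) g x =
      2 * polar N f₁ g x := by
    intro f₁ f₂
    have h1 := h.parallelogram (f₁ + g) f₂
    have h2 := h.parallelogram (f₁ - g) f₂
    rw [show f₁ + g + f₂ = f₁ + f₂ + g by abel, show f₁ + g - f₂ = f₁ - f₂ + g by abel] at h1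
    rw [show f₁ - g + f₂ = f₁ + f₂ - g by abel, show f₁ - g - f₂ = f₁ - f₂ - g by abel] at h2
    filter_upwards [h1, h2] with x h3 h4
    simp only [polar]
    linarith
  filter_upwards [key f₁ f₂, key f₂ f₁, h.polar_neg_left (f₁ - f₂) g] with x h1 h2 h3
  rw [neg_sub] at h3
  rw [add_comm f₂ f₁, h3] at h2
  linarith

/-- The polarisation as an additive map into germs. -/
def polarHom (h : IsPointwiseHilbertNorm μ N) (g : V) : V →+ Germ (ae μ) ℝ :=
  AddMonoidHom.mk' (fun f => (polar N f g : Germ (ae μ) ℝ)) fun f₁ f₂ => by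
    rw [← Germ.coe_add]
    exact Germ.coe_eq.2 (h.polar_add_left f₁ f₂ g)

/-- In germs additivity is an exact identity, so the general fact that additive maps are `ℚ`-linear
applies. -/
theorem polar_rat_smul_left (h : IsPointwiseHilbertNorm μ N) (q : ℚ) (f g : V) :
    ∀ᵐ x ∂μ, polar N ((q : ℝ) • f) g x = q * polar N f g x := by
  have h1 := map_ratCast_smul (h.polarHom g) ℝ ℝ q f
  have h2 : ((polar N ((q : ℝ) • f) g : α → ℝ) : Germ (ae μ) ℝ) =
      (((q : ℝ) • polar N f g : α → ℝ) : Germ (ae μ) ℝ) := h1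
  exact Germ.coe_eq.1 h2

/-- For rational `q` the remainder `(c - q) • f` is controlled by Cauchy–Schwarz; let `q → c` off
one null set. -/
theorem polar_smul_left (h : IsPointwiseHilbertNorm μ N) (c : ℝ) (f g : V) :
    ∀ᵐ x ∂μ, polar N (c • f) g x = c * polar N f g x := by
  have h1 : ∀ q : ℚ, ∀ᵐ x ∂μ, |polar N (c • f) g x - q * polar N f g x| ≤
      |c - q| * (N f x * N g x) := by
    intro q
    have h2 := h.polar_add_left ((q : ℝ) • f) ((c - q) • f) g
    rw [← add_smul, add_sub_cancel] at h2
    filter_upwards [h2, h.polar_rat_smul_left q f g, h.abs_polar_le ((c - q) • f) g,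
      h.smul (c - q) f] with x h3 h4 h5 h6
    rw [h3, h4, add_sub_cancel_left, ← mul_assoc, ← h6]
    exact h5
  filter_upwards [ae_all_iff.2 h1] with x hx
  have := le_of_forall_rat_le (F := fun q => |polar N (c • f) g x - q * polar N f g x|)
    (G := fun q => |c - q| * (N f x * N g x)) (by fun_prop) (by fun_prop) hx c
  rw [sub_self, abs_zero, zero_mul] at this
  exact sub_eq_zero.1 (abs_nonpos_iff.1 this)

theorem polar_linear_left (h : IsPointwiseHilbertNorm μ N) (a b : ℝ) (f₁ f₂ g : V) :
    ∀ᵐ x ∂μ, polar N (a • f₁ + b • f₂) g x = a * polar N f₁ g x + b * polar N f₂ g x := by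
  filter_upwards [h.polar_add_left (a • f₁) (b • f₂) g, h.polar_smul_left a f₁ g,
    h.polar_smul_left b f₂ g] with x h1 h2 h3
  rw [h1, h2, h3]

theorem sq_add_smul (h : IsPointwiseHilbertNorm μ N) (f g : V) (ε : ℝ) :
    ∀ᵐ x ∂μ, N (g + ε • f) x ^ 2 = N g x ^ 2 + 2 * ε * polar N f g x + ε ^ 2 * N f x ^ 2 := by
  filter_upwards [h.polar_self (g + ε • f), h.polar_add_left g (ε • f) (g + ε • f),
    h.polar_smul_left ε f (g + ε • f), h.polar_symm g (g + ε • f), h.polar_symm f (g + ε • f),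
    h.polar_add_left g (ε • f) g, h.polar_add_left g (ε • f) f, h.polar_smul_left ε f g,
    h.polar_smul_left ε f f, h.polar_self f, h.polar_self g, h.polar_symm f g]
    with x h1 h2 h3 h4 h5 h6 h7 h8 h9 h10 h11 h12
  rw [← h1, h2, h3, h4, h5, h6, h7, h8, h9, h10, h11, h12]
  ring

end IsPointwiseHilbertNorm

end Bilinear

/-! ### Local Sobolev functions and the local gradient -/

section Local

variable {X : Type*} [MetricSpace X]

/-- A Lipschitz cutoff equal to `1` on `ball x r` and supported in `closedBall x (2 * r)`. -/
def cutoff (x : X) (r : ℝ) (y : X) : ℝ := max 0 (min 1 (2 - dist y x / r))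

theorem cutoff_nonneg (x : X) (r : ℝ) (y : X) : 0 ≤ cutoff x r y := le_max_left _ _

theorem cutoff_le_one (x : X) (r : ℝ) (y : X) : cutoff x r y ≤ 1 :=
  max_le zero_le_one (min_le_left _ _)

theorem abs_cutoff_le_one (x : X) (r : ℝ) (y : X) : |cutoff x r y| ≤ 1 := by
  rw [abs_of_nonneg (cutoff_nonneg x r y)]
  exact cutoff_le_one x r y

theorem cutoff_eq_one {x : X} {r : ℝ} (hr : 0 < r) {y : X} (hy : y ∈ Metric.ball x r) :
    cutoff x r y = 1 := by
  have h1 : dist y x / r ≤ 1 := (div_le_one hr).2 (le_of_lt hy)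
  rw [cutoff, min_eq_left (by linarith), max_eq_right zero_le_one]

theorem exists_lipschitzWith_cutoff (x : X) {r : ℝ} (hr : 0 < r) :
    ∃ K : ℝ≥0, LipschitzWith K (cutoff x r) := by
  refine ⟨⟨r⁻¹, by positivity⟩, LipschitzWith.const_max (LipschitzWith.const_min ?_ 1) 0⟩
  refine LipschitzWith.of_le_add_mul _ fun y z => ?_
  have h1 := dist_triangle z y x
  have h2 : dist z x / r ≤ dist y x / r + r⁻¹ * dist y z := by
    rw [div_eq_inv_mul, div_eq_inv_mul, ← mul_add, dist_comm y z]
    gcongr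
    linarith
  change 2 - dist y x / r ≤ 2 - dist z x / r + r⁻¹ * dist y z
  linarith

theorem tsupport_cutoff_subset (x : X) {r : ℝ} (hr : 0 < r) :
    tsupport (cutoff x r) ⊆ Metric.closedBall x (2 * r) := by
  refine closure_minimal (fun y hy => ?_) Metric.isClosed_closedBall
  by_contra h
  rw [Metric.mem_closedBall, not_le, ← lt_div_iff₀ hr] at h
  refine hy ?_
  rw [cutoff, max_eq_left]
  exact (min_le_right _ _).trans (by linarith)

theorem eventually_closedBall_subset {U : Set X} {x : X} (hU : U ∈ 𝓝 x) :
    ∀ᶠ r in 𝓝[>] (0 : ℝ), Metric.closedBall x (2 * r) ⊆ U := by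
  obtain ⟨ε, hε, h⟩ := Metric.nhds_basis_closedBall.mem_iff.1 hU
  filter_upwards [Ioo_mem_nhdsGT (half_pos hε)] with r hr
  exact (Metric.closedBall_subset_closedBall (by linarith [hr.2])).trans h

theorem exists_pos_of_eventually {p : ℝ → Prop} (h : ∀ᶠ r in 𝓝[>] (0 : ℝ), p r) :
    ∃ r, 0 < r ∧ p r :=
  (eventually_mem_nhdsWithin.and h).exists

variable [MeasurableSpace X] [BorelSpace X] [SecondCountableTopology X] {m : Measure X}
  {Ω : Set X} {f g : X → ℝ}

theorem locGrad_nonneg (m : Measure X) (Ω : Set X) (f : X → ℝ) (x : X) : 0 ≤ locGrad m Ω f x := by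
  by_cases h : ∃ G, IsLocGrad m Ω f G
  · rw [locGrad, dif_pos h]; exact h.choose_spec.2.1 x
  · rw [locGrad, dif_neg h]; exact le_rfl

theorem measurable_locGrad (m : Measure X) (Ω : Set X) (f : X → ℝ) :
    Measurable (locGrad m Ω f) := by
  by_cases h : ∃ G, IsLocGrad m Ω f G
  · rw [locGrad, dif_pos h]; exact h.choose_spec.1
  · rw [locGrad, dif_neg h]; exact measurable_const

/-- Stated for all small radii, so that finitely many functions can share one cutoff. -/
theorem IsSobolevLoc.eventually_isSobolev (hf : IsSobolevLoc m Ω f) {x : X} (hx : x ∈ Ω) :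
    ∀ᶠ r in 𝓝[>] (0 : ℝ), IsSobolev m (fun y => f y * cutoff x r y) := by
  obtain ⟨U, hU, hxU, -, h⟩ := hf.2 x hx
  filter_upwards [eventually_closedBall_subset (hU.mem_nhds hxU), self_mem_nhdsWithin] with r hr hr0
  exact h _ (exists_lipschitzWith_cutoff x hr0) ((tsupport_cutoff_subset x hr0).trans hr)

/-- By Lindelöf, countably many balls on which some admissible cutoff equals `1` cover `Ω`. The
gradients of the cut-off functions agree on overlaps by locality, so the supremum of their
restrictions to the balls glues them. -/
theorem IsSobolevLoc.exists_isLocGrad (hf : IsSobolevLoc m Ω f) :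
    ∃ G, IsLocGrad m Ω f G := by
  have h1 : ∀ x ∈ Ω, ∃ r : ℝ, 0 < r ∧ IsSobolev m (fun y => f y * cutoff x r y) := fun x hx =>
    exists_pos_of_eventually (hf.eventually_isSobolev hx)
  choose! r hr hS using h1
  obtain ⟨t, htΩ, htc, ht⟩ := TopologicalSpace.countable_cover_nhdsWithin
    (f := fun x => Metric.ball x (r x)) (s := Ω)
    (fun x hx => mem_nhdsWithin_of_mem_nhds (Metric.ball_mem_nhds x (hr x hx)))
  have := htc.to_subtype
  set u : t → X → ℝ := fun i => minGrad m (fun y => f y * cutoff (i : X) (r i) y)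
  set h : X → ℝ := fun y => ⨆ i : t, (Metric.ball (i : X) (r i)).indicator (u i) y
  have hpos : ∀ (i : t) y, 0 ≤ (Metric.ball (i : X) (r i)).indicator (u i) y := fun i y =>
    indicator_nonneg (fun y _ => minGrad_nonneg _ _ y) y
  have hov : ∀ᵐ y ∂m, ∀ i j : t, y ∈ Metric.ball (i : X) (r i) → y ∈ Metric.ball (j : X) (r j) →
      u i y = u j y := by
    refine ae_all_iff.2 fun i => ae_all_iff.2 fun j => ?_
    filter_upwards [minGrad_eq_of_eq (hS i (htΩ i.2)) (hS j (htΩ j.2))] with y hy hi hj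
    exact hy (by rw [cutoff_eq_one (hr i (htΩ i.2)) hi, cutoff_eq_one (hr j (htΩ j.2)) hj])
  have hhu : ∀ᵐ y ∂m, ∀ i : t, y ∈ Metric.ball (i : X) (r i) → h y = u i y := by
    filter_upwards [hov] with y hy i hi
    have hne : Nonempty t := ⟨i⟩
    have hle : ∀ j : t, (Metric.ball (j : X) (r j)).indicator (u j) y ≤ u i y := by
      intro j
      by_cases hj : y ∈ Metric.ball (j : X) (r j)
      · rw [indicator_of_mem hj, hy i j hi hj]
      · rw [indicator_of_notMem hj]
        exact minGrad_nonneg _ _ y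
    refine le_antisymm (ciSup_le hle) ?_
    refine le_ciSup_of_le ⟨u i y, ?_⟩ i (by rw [indicator_of_mem hi])
    rintro _ ⟨j, rfl⟩
    exact hle j
  refine ⟨h, Measurable.iSup fun i => (measurable_minGrad _ _).indicator Metric.isOpen_ball.measurableSet,
    fun y => Real.iSup_nonneg fun i => hpos i y, fun χ _ hχ hfχ => ?_⟩
  have h2 : ∀ᵐ y ∂m, ∀ i : t, y ∈ Metric.ball (i : X) (r i) → χ y = 1 →
      u i y = minGrad m (fun y => f y * χ y) y := by
    refine ae_all_iff.2 fun i => ?_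
    filter_upwards [minGrad_eq_of_eq (hS i (htΩ i.2)) hfχ] with y hy hi h1
    exact hy (by rw [cutoff_eq_one (hr i (htΩ i.2)) hi, h1])
  filter_upwards [hhu, h2] with y h3 h4 h5
  have hy : y ∈ Ω := hχ (subset_tsupport _ (by simp [h5]))
  obtain ⟨i, hi, hyi⟩ := mem_iUnion₂.1 (ht hy)
  rw [h3 ⟨i, hi⟩ hyi]
  exact h4 ⟨i, hi⟩ hyi h5

theorem IsSobolevLoc.locGrad_spec (hf : IsSobolevLoc m Ω f) :
    IsLocGrad m Ω f (locGrad m Ω f) := by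
  have h := hf.exists_isLocGrad
  rw [locGrad, dif_pos h]
  exact h.choose_spec

/-- On small balls, the local gradient is the gradient of a cutoff of the function. -/
theorem IsSobolevLoc.eventually_locGrad (hΩ : IsOpen Ω) (hf : IsSobolevLoc m Ω f) {x : X}
    (hx : x ∈ Ω) : ∀ᶠ r in 𝓝[>] (0 : ℝ), IsSobolev m (fun y => f y * cutoff x r y) ∧
      ∀ᵐ y ∂m, y ∈ Metric.ball x r →
        locGrad m Ω f y = minGrad m (fun y => f y * cutoff x r y) y := by
  filter_upwards [hf.eventually_isSobolev hx, eventually_closedBall_subset (hΩ.mem_nhds hx),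
    self_mem_nhdsWithin] with r h1 h2 hr
  refine ⟨h1, ?_⟩
  filter_upwards [hf.locGrad_spec.2.2 _ (exists_lipschitzWith_cutoff x hr)
    ((tsupport_cutoff_subset x hr).trans h2) h1] with y hy hyr
  exact hy (cutoff_eq_one hr hyr)

theorem ae_of_eventually_ball {p : X → Prop} (h : ∀ x ∈ Ω, ∀ᶠ r in 𝓝[>] (0 : ℝ),
    ∀ᵐ y ∂m, y ∈ Metric.ball x r → p y) (hΩ : IsOpen Ω) : ∀ᵐ y ∂m.restrict Ω, p y := by
  rw [ae_restrict_iff' hΩ.measurableSet]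
  refine ae_of_locally fun x hx => ?_
  obtain ⟨r, hr, hp⟩ := exists_pos_of_eventually (h x hx)
  exact ⟨_, Metric.ball_mem_nhds x hr, hp⟩

theorem IsSobolevLoc.linear (hf : IsSobolevLoc m Ω f) (hg : IsSobolevLoc m Ω g) (α β : ℝ) :
    IsSobolevLoc m Ω (fun y => α * f y + β * g y) := by
  refine ⟨(hf.1.const_mul α).add (hg.1.const_mul β), fun x hx => ?_⟩
  obtain ⟨U, hU, hxU, hUΩ, h1⟩ := hf.2 x hx
  obtain ⟨V, hV, hxV, -, h2⟩ := hg.2 x hx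
  refine ⟨U ∩ V, hU.inter hV, ⟨hxU, hxV⟩, inter_subset_left.trans hUΩ, fun χ hχ hs => ?_⟩
  have h3 := (h1 χ hχ (hs.trans inter_subset_left)).linear (h2 χ hχ (hs.trans inter_subset_right)) α β
  have e : (fun y => α * (f y * χ y) + β * (g y * χ y)) = fun y => (α * f y + β * g y) * χ y := by
    ext y; ring
  rwa [e] at h3

/-- As `u` may be unbounded, `IsSobolev.mul` is not available. In `(φ(U) V)' = φ'(U) U' V + φ(U) V'`
the second term is at most `(|φ 0| + L |U|) |V'|`, and `U V' = (U V)' - U' V` is controlled because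
`u χ` is Sobolev. The first term and `U' V` each contribute `L * M`, whence the factor `2`. -/
theorem IsSobolev.comp_mul {u χ : X → ℝ} (hu : IsSobolev m u) {K L : ℝ≥0}
    (hχ : LipschitzWith K χ) {M : ℝ} (hM : ∀ x, |χ x| ≤ M) (hfin : m (Function.support χ) < ∞)
    (hw : IsSobolev m (fun x => u x * χ x)) {φ : ℝ → ℝ} (hφ : LipschitzWith L φ) :
    IsSobolev m (fun x => φ (u x) * χ x) := by
  have hX := LipschitzWith.isWeakUpperGradient hχ hfin
  have hU := hu.minGrad_wug
  have hW := hw.minGrad_wug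
  set s : X → ℝ := (Function.support χ).indicator fun _ => (K : ℝ)
  have hM0 : ∀ x : X, 0 ≤ M := fun x => (abs_nonneg _).trans (hM x)
  refine IsWeakUpperGradient.isSobolev (G := fun x => |2 * L * M| * minGrad m u x + |φ 0| * s x +
    L * minGrad m (fun x => u x * χ x) x) (.of_rep_real ?_ (fun x => ?_) ?_ fun π hπ => ?_) ?_
  · exact ((hU.measurable.const_mul _).add (hX.measurable.const_mul _)).add
      (hW.measurable.const_mul _)
  · have := hU.nonneg x
    have := hX.nonneg x
    have := hW.nonneg x
    positivity
  · exact ((hU.memLp.const_mul _).add (hX.memLp.const_mul _)).add (hW.memLp.const_mul _)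
  · filter_upwards [hU.exists_rep_real hu.1 hπ, hX.exists_rep_real hχ.continuous.measurable hπ,
      hW.exists_rep_real hw.1 hπ] with γ h1 h2 h3
    obtain ⟨U, hU, hUd⟩ := h1
    obtain ⟨V, hV, hVd⟩ := h2
    obtain ⟨W, hW, hWd⟩ := h3
    have hUV : IsACRep (fun x => u x * χ x) γ (fun t => U t * V t) := by
      refine ⟨hU.aci.mul hV.aci, ?_, ?_, ?_⟩
      · simp only [hU.zero, hV.zero]
      · simp only [hU.one, hV.one]
      · filter_upwards [hU.ae_eq, hV.ae_eq] with t h3 h4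
        rw [h3, h4]
    have hφU := hU.aci.comp_lipschitz hφ
    refine ⟨fun t => φ (U t) * V t, ⟨hφU.mul hV.aci, ?_, ?_, ?_⟩, ?_⟩
    · simp only [hU.zero, hV.zero]
    · simp only [hU.one, hV.one]
    · filter_upwards [hU.ae_eq, hV.ae_eq] with t h3 h4
      rw [h3, h4]
    · filter_upwards [hUd, hVd, hWd, hV.ae_eq, hφU.ae_deriv_mul hV.aci, hU.aci.ae_deriv_comp hφ,
        hU.aci.ae_deriv_mul hV.aci, hW.ae_deriv_eq hUV] with t d1 d2 d3 d4 d5 d6 d7 d8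
      rw [d5, d6]
      rw [d8, d7] at d3
      have a1 : |deriv φ (U t)| ≤ L := norm_deriv_le_of_lipschitz hφ
      have a2 : |φ (U t)| ≤ |φ 0| + L * |U t| := by
        have := hφ.dist_le_mul (U t) 0
        rw [Real.dist_eq, Real.dist_eq, sub_zero] at this
        have h5 := abs_add_le (φ (U t) - φ 0) (φ 0)
        rw [sub_add_cancel] at h5
        linarith
      have a3 : |V t| ≤ M := by rw [d4]; exact hM _
      have a4 : |U t * deriv V t| ≤ |deriv U t * V t + U t * deriv V t| + |deriv U t * V t| := by
        have := abs_sub (deriv U t * V t + U t * deriv V t) (deriv U t * V t)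
        rwa [add_sub_cancel_left] at this
      have a5 : |deriv U t * V t| ≤ M * |deriv U t| := by
        rw [abs_mul, mul_comm]
        gcongr
      have hL : (0 : ℝ) ≤ L := L.coe_nonneg
      have hMx := hM0 (γ t)
      have b1 : |deriv φ (U t) * deriv U t * V t| ≤ L * (M * |deriv U t|) := by
        rw [mul_assoc, abs_mul]
        exact mul_le_mul a1 a5 (abs_nonneg _) hL
      have b2 : |φ (U t) * deriv V t| ≤ |φ 0| * |deriv V t| + L * |U t * deriv V t| := by
        rw [abs_mul, abs_mul]
        calc |φ (U t)| * |deriv V t| ≤ (|φ 0| + L * |U t|) * |deriv V t| := by gcongr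
          _ = _ := by ring
      have b3 : L * |U t * deriv V t| ≤ L * (minGrad m (fun x => u x * χ x) (γ t) * realSpeed γ t +
          M * |deriv U t|) := by
        gcongr
        linarith
      have b4 : |φ 0| * |deriv V t| ≤ |φ 0| * (s (γ t) * realSpeed γ t) := by gcongr
      have b5 : 2 * L * M * |deriv U t| ≤ 2 * L * M * (minGrad m u (γ t) * realSpeed γ t) := by
        gcongr
      rw [abs_of_nonneg (by positivity : 0 ≤ 2 * L * M)]
      refine (abs_add_le _ _).trans ?_
      linarith
  · exact (hφ.continuous.measurable.comp hu.1).mul hχ.continuous.measurable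

theorem LipschitzWith.exists_abs_le {χ : X → ℝ} {K : ℝ≥0} (hχ : LipschitzWith K χ) {x : X} {r : ℝ}
    (hs : tsupport χ ⊆ Metric.ball x r) : ∃ M, ∀ y, |χ y| ≤ M := by
  refine ⟨|χ x| + K * |r|, fun y => ?_⟩
  by_cases hy : y ∈ Metric.ball x r
  · have h1 := hχ.dist_le_mul y x
    rw [Real.dist_eq] at h1
    have h2 := abs_add_le (χ y - χ x) (χ x)
    rw [sub_add_cancel] at h2
    have h3 : dist y x ≤ |r| := (le_of_lt hy).trans (le_abs_self r)
    have h4 : K * dist y x ≤ K * |r| := by gcongr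
    linarith
  · rw [image_eq_zero_of_notMem_tsupport (fun h => hy (hs h)), abs_zero]
    positivity

/-- On a ball of finite measure where the cutoff is `1`, `f` may be replaced by the Sobolev function
`f * cutoff` in both `f χ` and `φ(f) χ`, and `IsSobolev.comp_mul` applies. -/
theorem IsSobolevLoc.comp [IsLocallyFiniteMeasure m] (hf : IsSobolevLoc m Ω f) {φ : ℝ → ℝ}
    {L : ℝ≥0} (hφ : LipschitzWith L φ) : IsSobolevLoc m Ω (fun y => φ (f y)) := by
  refine ⟨hφ.continuous.measurable.comp hf.1, fun x hx => ?_⟩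
  obtain ⟨U, hU, hxU, hUΩ, h1⟩ := hf.2 x hx
  obtain ⟨B, hxB, hB, hBfin⟩ := m.exists_isOpen_measure_lt_top x
  obtain ⟨r, hr', h2, h3⟩ := exists_pos_of_eventually
    ((eventually_closedBall_subset ((hU.inter hB).mem_nhds ⟨hxU, hxB⟩)).and
      (hf.eventually_isSobolev hx))
  have hsub : Metric.ball x r ⊆ U ∩ B := Metric.ball_subset_closedBall.trans
    ((Metric.closedBall_subset_closedBall (by linarith)).trans h2)
  refine ⟨Metric.ball x r, Metric.isOpen_ball, Metric.mem_ball_self hr',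
    (hsub.trans inter_subset_left).trans hUΩ, fun χ hχ hs => ?_⟩
  obtain ⟨K, hK⟩ := hχ
  obtain ⟨M, hM⟩ := LipschitzWith.exists_abs_le hK hs
  have hone : ∀ y, χ y ≠ 0 → cutoff x r y = 1 := fun y hy =>
    cutoff_eq_one hr' (hs (subset_tsupport _ hy))
  have e1 : (fun y => f y * cutoff x r y * χ y) = fun y => f y * χ y := by
    ext y
    by_cases hy : χ y = 0
    · simp [hy]
    · rw [hone y hy, mul_one]
  have e2 : (fun y => φ (f y * cutoff x r y) * χ y) = fun y => φ (f y) * χ y := by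
    ext y
    by_cases hy : χ y = 0
    · simp [hy]
    · rw [hone y hy, mul_one]
  rw [← e2]
  refine h3.comp_mul hK hM ?_ ?_ hφ
  · exact (measure_mono ((subset_tsupport _).trans (hs.trans (hsub.trans inter_subset_right)))).trans_lt
      hBfin
  · rw [e1]
    exact h1 χ ⟨K, hK⟩ (hs.trans (hsub.trans inter_subset_left))

theorem IsLinftyLoc.eventually_abs_le (hf : IsLinftyLoc m Ω f) {x : X} (hx : x ∈ Ω) :
    ∀ᶠ r in 𝓝[>] (0 : ℝ), ∃ M, ∀ᵐ y ∂m, y ∈ Metric.closedBall x (2 * r) → |f y| ≤ M := by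
  obtain ⟨U, hU, hxU, -, M, hM⟩ := hf x hx
  filter_upwards [eventually_closedBall_subset (hU.mem_nhds hxU)] with r hr
  refine ⟨M, ?_⟩
  filter_upwards [hM] with y hy h using hy (hr h)

theorem ae_abs_mul_le {χ : X → ℝ} {C : Set X} {M N : ℝ} (hf : ∀ᵐ y ∂m, y ∈ C → |f y| ≤ M)
    (hχ : ∀ y, |χ y| ≤ N) (hs : tsupport χ ⊆ C) : ∀ᵐ y ∂m, |f y * χ y| ≤ |M| * N := by
  filter_upwards [hf] with y hy
  rw [abs_mul]
  by_cases h : χ y = 0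
  · have := (abs_nonneg _).trans (hχ y)
    rw [h, abs_zero, mul_zero]
    positivity
  · exact mul_le_mul ((hy (hs (subset_tsupport _ h))).trans (le_abs_self _)) (hχ y)
      (abs_nonneg _) (abs_nonneg _)

theorem IsSobolevLoc.mul (hf : IsSobolevLoc m Ω f) (hg : IsSobolevLoc m Ω g)
    (hfb : IsLinftyLoc m Ω f) (hgb : IsLinftyLoc m Ω g) :
    IsSobolevLoc m Ω (fun y => f y * g y) := by
  refine ⟨hf.1.mul hg.1, fun x hx => ?_⟩
  obtain ⟨U, hU, hxU, hUΩ, h1⟩ := hf.2 x hx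
  obtain ⟨r, hr', h2, h3, ⟨M, hM⟩, N, hN⟩ := exists_pos_of_eventually
    ((eventually_closedBall_subset (hU.mem_nhds hxU)).and ((hg.eventually_isSobolev hx).and
      ((hfb.eventually_abs_le hx).and (hgb.eventually_abs_le hx))))
  have hsub : Metric.ball x r ⊆ Metric.closedBall x (2 * r) := Metric.ball_subset_closedBall.trans
    (Metric.closedBall_subset_closedBall (by linarith))
  refine ⟨Metric.ball x r, Metric.isOpen_ball, Metric.mem_ball_self hr',
    (hsub.trans h2).trans hUΩ, fun χ hχ hs => ?_⟩
  obtain ⟨K, hK⟩ := hχ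
  obtain ⟨M', hM'⟩ := LipschitzWith.exists_abs_le hK hs
  have e : (fun y => (f y * χ y) * (g y * cutoff x r y)) = fun y => f y * g y * χ y := by
    ext y
    by_cases hy : χ y = 0
    · simp [hy]
    · rw [cutoff_eq_one hr' (hs (subset_tsupport _ hy))]
      ring
  rw [← e]
  exact (h1 χ ⟨K, hK⟩ (hs.trans (hsub.trans h2))).mul h3 (ae_abs_mul_le hM hM' (hs.trans hsub))
    (ae_abs_mul_le hN (abs_cutoff_le_one x r) (tsupport_cutoff_subset x hr'))

theorem IsSobolevLoc.locGrad_add_le (hΩ : IsOpen Ω) (hf : IsSobolevLoc m Ω f)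
    (hg : IsSobolevLoc m Ω g) (hfg : IsSobolevLoc m Ω (fun y => f y + g y)) :
    ∀ᵐ y ∂m.restrict Ω, locGrad m Ω (fun y => f y + g y) y ≤ locGrad m Ω f y + locGrad m Ω g y := by
  refine ae_of_eventually_ball (fun x hx => ?_) hΩ
  filter_upwards [hf.eventually_locGrad hΩ hx, hg.eventually_locGrad hΩ hx,
    hfg.eventually_locGrad hΩ hx] with r h1 h2 h3
  have h4 := h1.1.minGrad_add_le h2.1
  have e : (fun y => f y * cutoff x r y + g y * cutoff x r y) =
    fun y => (f y + g y) * cutoff x r y := by ext y; ring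
  rw [e] at h4
  filter_upwards [h1.2, h2.2, h3.2, h4] with y d1 d2 d3 d4 hy
  rw [d1 hy, d2 hy, d3 hy]
  exact d4

theorem IsSobolevLoc.locGrad_const_mul (hΩ : IsOpen Ω) (hf : IsSobolevLoc m Ω f) (c : ℝ)
    (hcf : IsSobolevLoc m Ω (fun y => c * f y)) :
    ∀ᵐ y ∂m.restrict Ω, locGrad m Ω (fun y => c * f y) y = |c| * locGrad m Ω f y := by
  refine ae_of_eventually_ball (fun x hx => ?_) hΩ
  filter_upwards [hf.eventually_locGrad hΩ hx, hcf.eventually_locGrad hΩ hx] with r h1 h2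
  have h4 := h1.1.minGrad_const_mul c
  simp only [← mul_assoc] at h4
  filter_upwards [h1.2, h2.2, h4] with y d1 d2 d4 hy
  rw [d1 hy, d2 hy]
  exact d4

theorem IsSobolevLoc.locGrad_parallelogram [IsLocallyFiniteMeasure m]
    (hm : InfinitesimallyHilbertian m) (hΩ : IsOpen Ω) (hf : IsSobolevLoc m Ω f)
    (hg : IsSobolevLoc m Ω g) (hfg : IsSobolevLoc m Ω (fun y => f y + g y))
    (hfg' : IsSobolevLoc m Ω (fun y => f y - g y)) :
    ∀ᵐ y ∂m.restrict Ω, locGrad m Ω (fun y => f y + g y) y ^ 2 +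
      locGrad m Ω (fun y => f y - g y) y ^ 2 =
        2 * (locGrad m Ω f y ^ 2 + locGrad m Ω g y ^ 2) := by
  refine ae_of_eventually_ball (fun x hx => ?_) hΩ
  filter_upwards [hf.eventually_locGrad hΩ hx, hg.eventually_locGrad hΩ hx,
    hfg.eventually_locGrad hΩ hx, hfg'.eventually_locGrad hΩ hx] with r h1 h2 h3 h3'
  have h4 := hm.parallelogram h1.1 h2.1
  simp only [← add_mul, ← sub_mul] at h4
  filter_upwards [h1.2, h2.2, h3.2, h3'.2, h4] with y d1 d2 d3 d3' d4 hy
  rw [d1 hy, d2 hy, d3 hy, d3' hy]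
  exact d4

theorem IsSobolevLoc.locGrad_comp_le [IsLocallyFiniteMeasure m] (hΩ : IsOpen Ω)
    (hf : IsSobolevLoc m Ω f) {φ : ℝ → ℝ} {L : ℝ≥0} (hφ : LipschitzWith L φ) :
    ∀ᵐ y ∂m.restrict Ω, locGrad m Ω (fun y => φ (f y)) y ≤ |deriv φ (f y)| * locGrad m Ω f y := by
  refine ae_of_eventually_ball (fun x hx => ?_) hΩ
  filter_upwards [hf.eventually_locGrad hΩ hx, (hf.comp hφ).eventually_locGrad hΩ hx,
    self_mem_nhdsWithin] with r h1 h2 hr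
  filter_upwards [h1.2, h2.2, h1.1.minGrad_comp_le hφ, minGrad_eq_of_eq h2.1 (h1.1.comp hφ)]
    with y d1 d2 d3 d4 hy
  have hy1 := cutoff_eq_one hr hy
  rw [hy1, mul_one, mul_one] at d4
  rw [hy1, mul_one] at d3
  rw [d1 hy, d2 hy, d4 rfl]
  exact d3

theorem IsSobolevLoc.locGrad_mul_le (hΩ : IsOpen Ω) (hf : IsSobolevLoc m Ω f)
    (hg : IsSobolevLoc m Ω g) (hfb : IsLinftyLoc m Ω f) (hgb : IsLinftyLoc m Ω g) :
    ∀ᵐ y ∂m.restrict Ω, locGrad m Ω (fun y => f y * g y) y ≤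
      |f y| * locGrad m Ω g y + |g y| * locGrad m Ω f y := by
  refine ae_of_eventually_ball (fun x hx => ?_) hΩ
  filter_upwards [hf.eventually_locGrad hΩ hx, hg.eventually_locGrad hΩ hx,
    (hf.mul hg hfb hgb).eventually_locGrad hΩ hx, hfb.eventually_abs_le hx,
    hgb.eventually_abs_le hx, self_mem_nhdsWithin] with r h1 h2 h3 h4 h5 hr
  obtain ⟨M, hM⟩ := h4
  obtain ⟨N, hN⟩ := h5
  have hM' := ae_abs_mul_le hM (abs_cutoff_le_one x r) (tsupport_cutoff_subset x hr)
  have hN' := ae_abs_mul_le hN (abs_cutoff_le_one x r) (tsupport_cutoff_subset x hr)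
  filter_upwards [h1.2, h2.2, h3.2, h1.1.minGrad_mul_le h2.1 hM' hN',
    minGrad_eq_of_eq h3.1 (h1.1.mul h2.1 hM' hN')] with y d1 d2 d3 d4 d5 hy
  have hy1 := cutoff_eq_one hr hy
  simp only [hy1, mul_one] at d4 d5
  rw [d1 hy, d2 hy, d3 hy, d5 trivial]
  exact d4

end Local

/-! ### The scalar product of gradients and its calculus rules -/

section GradDot

variable {X : Type*} [MetricSpace X] [MeasurableSpace X] [BorelSpace X]
  [SecondCountableTopology X] {m : Measure X} {Ω : Set X} {f g : X → ℝ}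

theorem isSobolev_zero (m : Measure X) : IsSobolev m (fun _ => 0) :=
  (LipschitzWith.isWeakUpperGradient (K := 0) (LipschitzWith.const 0) (by simp)).isSobolev
    measurable_const

/-- The vector space `S²_loc(Ω)`. -/
def sobolevLoc (m : Measure X) (Ω : Set X) (hΩ : IsOpen Ω) : Submodule ℝ (X → ℝ) where
  carrier := {f | IsSobolevLoc m Ω f}
  add_mem' {f g} hf hg := by
    have h := IsSobolevLoc.linear hf hg 1 1
    simp only [one_mul] at h
    exact h
  zero_mem' := by
    refine IsSobolevLoc.of_forall hΩ measurable_const fun χ _ _ => ?_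
    simpa using isSobolev_zero m
  smul_mem' c f hf := by
    have h := IsSobolevLoc.linear hf hf c 0
    simp only [zero_mul, add_zero] at h
    exact h

/-- The local gradient as a function-valued seminorm on `S²_loc(Ω)`. -/
def locNorm (m : Measure X) (Ω : Set X) (hΩ : IsOpen Ω) (f : sobolevLoc m Ω hΩ) : X → ℝ :=
  locGrad m Ω f.1

theorem isPointwiseHilbertNorm_locNorm [IsLocallyFiniteMeasure m]
    (hm : InfinitesimallyHilbertian m) (hΩ : IsOpen Ω) :
    IsPointwiseHilbertNorm (m.restrict Ω) (locNorm m Ω hΩ) where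
  nonneg _ _ := locGrad_nonneg _ _ _ _
  add_le f g := IsSobolevLoc.locGrad_add_le hΩ f.2 g.2 (f + g).2
  smul c f := IsSobolevLoc.locGrad_const_mul hΩ f.2 c (c • f).2
  parallelogram f g :=
    IsSobolevLoc.locGrad_parallelogram hm hΩ f.2 g.2 (f + g).2 (f - g).2

theorem IsEssInf.ae_eq {α ι : Type*} [MeasurableSpace α] {μ : Measure α} {S : Set ι}
    {q : ι → α → ℝ} {h h' : α → ℝ} (hh : IsEssInf μ S q h) (hh' : IsEssInf μ S q h') :
    h =ᵐ[μ] h' :=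
  (hh'.2.2 h hh.1 hh.2.1).antisymm (hh.2.2 h' hh'.1 hh'.2.1)

/-- The difference quotient equals the polar form plus `ε / 2` times `|DF|²`. It therefore lies
above the polar form and decreases to it along `ε = 1 / (n + 1)`. -/
theorem isEssInf_polar [IsLocallyFiniteMeasure m] (hm : InfinitesimallyHilbertian m)
    (hΩ : IsOpen Ω) (F G : sobolevLoc m Ω hΩ) :
    IsEssInf (m.restrict Ω) (Ioi (0 : ℝ)) (gradQuotient m Ω F G) (polar (locNorm m Ω hΩ) F G) := by
  have hN := isPointwiseHilbertNorm_locNorm hm hΩ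
  have hq : ∀ ε : ℝ, 0 < ε → ∀ᵐ x ∂m.restrict Ω, gradQuotient m Ω F G ε x =
      polar (locNorm m Ω hΩ) F G x + ε / 2 * locNorm m Ω hΩ F x ^ 2 := by
    intro ε hε
    filter_upwards [hN.sq_add_smul F G ε] with x hx
    change (locNorm m Ω hΩ (G + ε • F) x ^ 2 - locNorm m Ω hΩ G x ^ 2) / (2 * ε) = _
    rw [hx]
    field_simp
    ring
  refine ⟨?_, fun ε hε => ?_, fun h _ hle => ?_⟩
  · exact (((measurable_locGrad _ _ _).pow_const 2).sub
      ((measurable_locGrad _ _ _).pow_const 2)).div_const 4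
  · filter_upwards [hq ε hε] with x hx
    rw [hx]
    have : 0 ≤ ε / 2 * locNorm m Ω hΩ F x ^ 2 :=
      mul_nonneg (half_pos hε).le (sq_nonneg _)
    linarith
  · have h1 : ∀ n : ℕ, ∀ᵐ x ∂m.restrict Ω, h x ≤
        polar (locNorm m Ω hΩ) F G x + 1 / ((n : ℝ) + 1) / 2 * locNorm m Ω hΩ F x ^ 2 := by
      intro n
      have hn : (0 : ℝ) < 1 / ((n : ℝ) + 1) := by positivity
      filter_upwards [hq _ hn, hle _ hn] with x h2 h3
      rwa [← h2]
    filter_upwards [ae_all_iff.2 h1] with x hx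
    have hlim : Tendsto (fun n : ℕ => polar (locNorm m Ω hΩ) F G x +
        1 / ((n : ℝ) + 1) / 2 * locNorm m Ω hΩ F x ^ 2) atTop
        (𝓝 (polar (locNorm m Ω hΩ) F G x + 0 / 2 * locNorm m Ω hΩ F x ^ 2)) :=
      ((tendsto_one_div_add_atTop_nhds_zero_nat.div_const 2).mul_const _).const_add _
    simpa using ge_of_tendsto' hlim hx

theorem gradDot_spec [IsLocallyFiniteMeasure m] (hm : InfinitesimallyHilbertian m)
    (hΩ : IsOpen Ω) (hf : IsSobolevLoc m Ω f) (hg : IsSobolevLoc m Ω g) :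
    IsEssInf (m.restrict Ω) (Ioi (0 : ℝ)) (gradQuotient m Ω f g) (gradDot m Ω f g) := by
  have h : ∃ p : X → ℝ, IsEssInf (m.restrict Ω) (Ioi (0 : ℝ)) (gradQuotient m Ω f g) p :=
    ⟨_, isEssInf_polar hm hΩ ⟨f, hf⟩ ⟨g, hg⟩⟩
  rw [gradDot, dif_pos h]
  exact h.choose_spec

theorem gradDot_ae_eq [IsLocallyFiniteMeasure m] (hm : InfinitesimallyHilbertian m)
    (hΩ : IsOpen Ω) (F G : sobolevLoc m Ω hΩ) :
    ∀ᵐ x ∂m.restrict Ω, gradDot m Ω F G x = polar (locNorm m Ω hΩ) F G x :=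
  (gradDot_spec hm hΩ F.2 G.2).ae_eq (isEssInf_polar hm hΩ F G)

theorem gradDot_symm [IsLocallyFiniteMeasure m] (hm : InfinitesimallyHilbertian m)
    (hΩ : IsOpen Ω) (hf : IsSobolevLoc m Ω f) (hg : IsSobolevLoc m Ω g) :
    ∀ᵐ x ∂m.restrict Ω, gradDot m Ω f g x = gradDot m Ω g f x := by
  let F : sobolevLoc m Ω hΩ := ⟨f, hf⟩
  let G : sobolevLoc m Ω hΩ := ⟨g, hg⟩
  filter_upwards [gradDot_ae_eq hm hΩ F G, gradDot_ae_eq hm hΩ G F,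
    (isPointwiseHilbertNorm_locNorm hm hΩ).polar_symm F G] with x h1 h2 h3
  exact h1.trans (h3.trans h2.symm)

theorem gradDot_self [IsLocallyFiniteMeasure m] (hm : InfinitesimallyHilbertian m)
    (hΩ : IsOpen Ω) (hf : IsSobolevLoc m Ω f) :
    ∀ᵐ x ∂m.restrict Ω, gradDot m Ω f f x = locGrad m Ω f x ^ 2 := by
  let F : sobolevLoc m Ω hΩ := ⟨f, hf⟩
  filter_upwards [gradDot_ae_eq hm hΩ F F,
    (isPointwiseHilbertNorm_locNorm hm hΩ).polar_self F] with x h1 h2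
  exact h1.trans h2

theorem abs_gradDot_le [IsLocallyFiniteMeasure m] (hm : InfinitesimallyHilbertian m)
    (hΩ : IsOpen Ω) (hf : IsSobolevLoc m Ω f) (hg : IsSobolevLoc m Ω g) :
    ∀ᵐ x ∂m.restrict Ω, |gradDot m Ω f g x| ≤ locGrad m Ω f x * locGrad m Ω g x := by
  let F : sobolevLoc m Ω hΩ := ⟨f, hf⟩
  let G : sobolevLoc m Ω hΩ := ⟨g, hg⟩
  filter_upwards [gradDot_ae_eq hm hΩ F G,
    (isPointwiseHilbertNorm_locNorm hm hΩ).abs_polar_le F G] with x h1 h2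
  exact (congrArg abs h1).trans_le h2

theorem gradDot_linear_left [IsLocallyFiniteMeasure m] (hm : InfinitesimallyHilbertian m)
    (hΩ : IsOpen Ω) {f₁ f₂ : X → ℝ} (hf₁ : IsSobolevLoc m Ω f₁) (hf₂ : IsSobolevLoc m Ω f₂)
    (hg : IsSobolevLoc m Ω g) (α β : ℝ) :
    ∀ᵐ x ∂m.restrict Ω, gradDot m Ω (fun y => α * f₁ y + β * f₂ y) g x =
      α * gradDot m Ω f₁ g x + β * gradDot m Ω f₂ g x := by
  let F₁ : sobolevLoc m Ω hΩ := ⟨f₁, hf₁⟩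
  let F₂ : sobolevLoc m Ω hΩ := ⟨f₂, hf₂⟩
  let G : sobolevLoc m Ω hΩ := ⟨g, hg⟩
  filter_upwards [gradDot_ae_eq hm hΩ F₁ G, gradDot_ae_eq hm hΩ F₂ G,
    gradDot_ae_eq hm hΩ (α • F₁ + β • F₂) G,
    (isPointwiseHilbertNorm_locNorm hm hΩ).polar_linear_left α β F₁ F₂ G] with x h1 h2 h3 h4
  change gradDot m Ω f₁ g x = _ at h1
  change gradDot m Ω f₂ g x = _ at h2
  rw [h1, h2]
  exact h3.trans h4

/-- Apply Cauchy–Schwarz and the chain inequality to `φ t - c * t`: the error carries the factor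
`|φ'(f x) - c|`, which vanishes for `c = φ'(f x)`. -/
theorem gradDot_comp_left [IsLocallyFiniteMeasure m] (hm : InfinitesimallyHilbertian m)
    (hΩ : IsOpen Ω) (hf : IsSobolevLoc m Ω f) (hg : IsSobolevLoc m Ω g) {φ : ℝ → ℝ} {K : ℝ≥0}
    (hφ : LipschitzWith K φ) :
    ∀ᵐ x ∂m.restrict Ω, gradDot m Ω (fun y => φ (f y)) g x =
      deriv φ (f x) * gradDot m Ω f g x := by
  have key : ∀ c : ℝ, ∀ᵐ x ∂m.restrict Ω,
      |gradDot m Ω (fun y => φ (f y)) g x - c * gradDot m Ω f g x| ≤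
        |deriv (fun t => φ t - c * t) (f x)| * (locGrad m Ω f x * locGrad m Ω g x) := by
    intro c
    have hψ : LipschitzWith (K + ‖c‖₊) (fun t => φ t - c * t) := hφ.sub (lipschitzWith_smul c)
    have e : (fun y => 1 * φ (f y) + -c * f y) = fun y => φ (f y) - c * f y := by ext y; ring
    have h1 := gradDot_linear_left hm hΩ (hf.comp hφ) hf hg 1 (-c)
    rw [e] at h1
    filter_upwards [h1, abs_gradDot_le hm hΩ (hf.comp hψ) hg, hf.locGrad_comp_le hΩ hψ]
      with x h2 h3 h4
    rw [h2] at h3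
    rw [one_mul, neg_mul, ← sub_eq_add_neg] at h3
    refine h3.trans ?_
    rw [← mul_assoc]
    exact mul_le_mul_of_nonneg_right h4 (locGrad_nonneg _ _ _ _)
  filter_upwards [key 0, ae_all_iff.2 fun q : ℚ => key q] with x h0 hq
  by_cases hd : DifferentiableAt ℝ φ (f x)
  · have h1 : ∀ c : ℝ, deriv (fun t => φ t - c * t) (f x) = deriv φ (f x) - c := by
      intro c
      rw [deriv_fun_sub hd (by fun_prop)]
      simp
    simp only [h1] at hq
    have h2 := le_of_forall_rat_le
      (F := fun c => |gradDot m Ω (fun y => φ (f y)) g x - c * gradDot m Ω f g x|)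
      (G := fun c => |deriv φ (f x) - c| * (locGrad m Ω f x * locGrad m Ω g x))
      (by fun_prop) (by fun_prop) hq (deriv φ (f x))
    rw [sub_self, abs_zero, zero_mul] at h2
    exact sub_eq_zero.1 (abs_nonpos_iff.1 h2)
  -- Without differentiability the case `c = 0` suffices: its bound contains `deriv φ (f x)`, which
  -- is `0` by convention.
  · simp only [zero_mul, sub_zero, deriv_zero_of_not_differentiableAt hd, abs_zero] at h0 ⊢
    exact abs_nonpos_iff.1 h0

theorem IsLinftyLoc.sub_const (hf : IsLinftyLoc m Ω f) (a : ℝ) :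
    IsLinftyLoc m Ω (fun y => f y - a) := by
  intro x hx
  obtain ⟨U, hU, hxU, hUΩ, M, hM⟩ := hf x hx
  refine ⟨U, hU, hxU, hUΩ, M + |a|, ?_⟩
  filter_upwards [hM] with y hy hyU
  exact (abs_sub _ _).trans (by linarith [hy hyU])

theorem lipschitzWith_sub_const (a : ℝ) : LipschitzWith 1 (fun t : ℝ => t - a) :=
  LipschitzWith.of_dist_le_mul fun x y => by simp

theorem IsSobolevLoc.locGrad_sub_const_le [IsLocallyFiniteMeasure m] (hΩ : IsOpen Ω)
    (hf : IsSobolevLoc m Ω f) (a : ℝ) :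
    ∀ᵐ x ∂m.restrict Ω, locGrad m Ω (fun y => f y - a) x ≤ locGrad m Ω f x := by
  filter_upwards [hf.locGrad_comp_le hΩ (lipschitzWith_sub_const a)] with x hx
  simpa using hx

theorem gradDot_mul_left [IsLocallyFiniteMeasure m] (hm : InfinitesimallyHilbertian m)
    (hΩ : IsOpen Ω) {f₁ f₂ : X → ℝ} (hf₁ : IsSobolevLoc m Ω f₁) (hf₂ : IsSobolevLoc m Ω f₂)
    (hb₁ : IsLinftyLoc m Ω f₁) (hb₂ : IsLinftyLoc m Ω f₂) (hg : IsSobolevLoc m Ω g) :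
    ∀ᵐ x ∂m.restrict Ω, gradDot m Ω (fun y => f₁ y * f₂ y) g x =
      f₁ x * gradDot m Ω f₂ g x + f₂ x * gradDot m Ω f₁ g x := by
  have h12 := hf₁.mul hf₂ hb₁ hb₂
  -- Since `f₁ f₂ - a f₂ - b f₁ = (f₁ - a)(f₂ - b) - a b`, the Leibniz inequality gives a bound that
  -- vanishes for `a = f₁ x`, `b = f₂ x`; these values are reached from rational ones, first in `a`,
  -- then in `b`.
  have key : ∀ a b : ℝ, ∀ᵐ x ∂m.restrict Ω,
      |gradDot m Ω (fun y => f₁ y * f₂ y) g x - a * gradDot m Ω f₂ g x - b * gradDot m Ω f₁ g x| ≤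
        (|f₁ x - a| * locGrad m Ω f₂ x + |f₂ x - b| * locGrad m Ω f₁ x) * locGrad m Ω g x := by
    intro a b
    have k₁ := hf₁.comp (lipschitzWith_sub_const a)
    have k₂ := hf₂.comp (lipschitzWith_sub_const b)
    have c₁ := hb₁.sub_const a
    have c₂ := hb₂.sub_const b
    have l := hf₂.linear hf₁ (-a) (-b)
    have h0 := h12.linear l 1 1
    have e : (fun y => 1 * (f₁ y * f₂ y) + 1 * (-a * f₂ y + -b * f₁ y)) =
      fun y => (f₁ y - a) * (f₂ y - b) - a * b := by ext y; ring
    have h1 := gradDot_linear_left hm hΩ h12 l hg 1 1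
    have h2 := abs_gradDot_le hm hΩ h0 hg
    rw [e] at h1 h2
    filter_upwards [h1, gradDot_linear_left hm hΩ hf₂ hf₁ hg (-a) (-b), h2,
      (k₁.mul k₂ c₁ c₂).locGrad_sub_const_le hΩ (a * b), k₁.locGrad_mul_le hΩ k₂ c₁ c₂,
      hf₁.locGrad_sub_const_le hΩ a, hf₂.locGrad_sub_const_le hΩ b] with x d1 d2 d3 d4 d5 d6 d7
    rw [d1, d2] at d3
    have e2 : gradDot m Ω (fun y => f₁ y * f₂ y) g x - a * gradDot m Ω f₂ g x -
        b * gradDot m Ω f₁ g x = 1 * gradDot m Ω (fun y => f₁ y * f₂ y) g x +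
        1 * (-a * gradDot m Ω f₂ g x + -b * gradDot m Ω f₁ g x) := by ring
    rw [e2]
    refine d3.trans (mul_le_mul_of_nonneg_right (d4.trans (d5.trans ?_)) (locGrad_nonneg _ _ _ _))
    gcongr
  have key' := ae_all_iff.2 fun q : ℚ => ae_all_iff.2 fun r : ℚ => key q r
  filter_upwards [key'] with x hx
  have h1 : ∀ r : ℚ, _ := fun r : ℚ => le_of_forall_rat_le
    (F := fun a => |gradDot m Ω (fun y => f₁ y * f₂ y) g x - a * gradDot m Ω f₂ g x -
      r * gradDot m Ω f₁ g x|)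
    (G := fun a => (|f₁ x - a| * locGrad m Ω f₂ x + |f₂ x - r| * locGrad m Ω f₁ x) *
      locGrad m Ω g x) (by fun_prop) (by fun_prop) (fun q => hx q r) (f₁ x)
  have h2 := le_of_forall_rat_le
    (F := fun b => |gradDot m Ω (fun y => f₁ y * f₂ y) g x - f₁ x * gradDot m Ω f₂ g x -
      b * gradDot m Ω f₁ g x|)
    (G := fun b => (|f₁ x - f₁ x| * locGrad m Ω f₂ x + |f₂ x - b| * locGrad m Ω f₁ x) *
      locGrad m Ω g x) (by fun_prop) (by fun_prop) h1 (f₂ x)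
  simp only [sub_self, abs_zero, zero_mul, add_zero] at h2
  have h3 := abs_nonpos_iff.1 h2
  linarith

end GradDot

end SobolevMMS

end

theorem mainTheorem5 {X : Type*} [MetricSpace X] [CompleteSpace X]
    [TopologicalSpace.SeparableSpace X] [MeasurableSpace X] [BorelSpace X]
    (m : Measure X) [IsLocallyFiniteMeasure m]
    (hm : SobolevMMS.InfinitesimallyHilbertian m) (Ω : Set X) (hΩ : IsOpen Ω) :
    -- the minimal weak upper gradients and the object `∇f · ∇g` are well defined
    ((∀ f : X → ℝ, SobolevMMS.IsSobolev m f →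
        SobolevMMS.IsMinimalWeakUpperGradient m f (SobolevMMS.minGrad m f)) ∧
      (∀ f : X → ℝ, SobolevMMS.IsSobolevLoc m Ω f →
        SobolevMMS.IsLocGrad m Ω f (SobolevMMS.locGrad m Ω f)) ∧
      (∀ f g : X → ℝ, SobolevMMS.IsSobolevLoc m Ω f → SobolevMMS.IsSobolevLoc m Ω g →
        SobolevMMS.IsEssInf (m.restrict Ω) (Ioi (0 : ℝ)) (SobolevMMS.gradQuotient m Ω f g)
          (SobolevMMS.gradDot m Ω f g))) ∧
    -- Cauchy-Schwarz
    (∀ f g : X → ℝ, SobolevMMS.IsSobolevLoc m Ω f → SobolevMMS.IsSobolevLoc m Ω g →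
      (∀ᵐ x ∂m.restrict Ω,
        SobolevMMS.gradDot m Ω f f x = SobolevMMS.locGrad m Ω f x ^ 2) ∧
      (∀ᵐ x ∂m.restrict Ω,
        |SobolevMMS.gradDot m Ω f g x| ≤
          SobolevMMS.locGrad m Ω f x * SobolevMMS.locGrad m Ω g x)) ∧
    -- linearity in the first and in the second argument
    (∀ f₁ f₂ g : X → ℝ, SobolevMMS.IsSobolevLoc m Ω f₁ → SobolevMMS.IsSobolevLoc m Ω f₂ →
      SobolevMMS.IsSobolevLoc m Ω g → ∀ α β : ℝ,
      SobolevMMS.IsSobolevLoc m Ω (fun y => α * f₁ y + β * f₂ y) ∧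
      (∀ᵐ x ∂m.restrict Ω,
        SobolevMMS.gradDot m Ω (fun y => α * f₁ y + β * f₂ y) g x =
          α * SobolevMMS.gradDot m Ω f₁ g x + β * SobolevMMS.gradDot m Ω f₂ g x) ∧
      (∀ᵐ x ∂m.restrict Ω,
        SobolevMMS.gradDot m Ω g (fun y => α * f₁ y + β * f₂ y) x =
          α * SobolevMMS.gradDot m Ω g f₁ x + β * SobolevMMS.gradDot m Ω g f₂ x)) ∧
    -- chain rule in the first and in the second argument;
    -- `deriv φ` is `0` where `φ` is not differentiable
    (∀ f g : X → ℝ, SobolevMMS.IsSobolevLoc m Ω f → SobolevMMS.IsSobolevLoc m Ω g →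
      ∀ φ : ℝ → ℝ, (∃ K : ℝ≥0, LipschitzWith K φ) →
      SobolevMMS.IsSobolevLoc m Ω (fun y => φ (f y)) ∧
      (∀ᵐ x ∂m.restrict Ω,
        SobolevMMS.gradDot m Ω (fun y => φ (f y)) g x =
          deriv φ (f x) * SobolevMMS.gradDot m Ω f g x) ∧
      (∀ᵐ x ∂m.restrict Ω,
        SobolevMMS.gradDot m Ω g (fun y => φ (f y)) x =
          deriv φ (f x) * SobolevMMS.gradDot m Ω g f x)) ∧
    -- Leibniz rule in the first and in the second argument
    (∀ f₁ f₂ g : X → ℝ, SobolevMMS.IsSobolevLoc m Ω f₁ → SobolevMMS.IsSobolevLoc m Ω f₂ →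
      SobolevMMS.IsLinftyLoc m Ω f₁ → SobolevMMS.IsLinftyLoc m Ω f₂ →
      SobolevMMS.IsSobolevLoc m Ω g →
      SobolevMMS.IsSobolevLoc m Ω (fun y => f₁ y * f₂ y) ∧
      (∀ᵐ x ∂m.restrict Ω,
        SobolevMMS.gradDot m Ω (fun y => f₁ y * f₂ y) g x =
          f₁ x * SobolevMMS.gradDot m Ω f₂ g x + f₂ x * SobolevMMS.gradDot m Ω f₁ g x) ∧
      (∀ᵐ x ∂m.restrict Ω,
        SobolevMMS.gradDot m Ω g (fun y => f₁ y * f₂ y) x =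
          f₁ x * SobolevMMS.gradDot m Ω g f₂ x + f₂ x * SobolevMMS.gradDot m Ω g f₁ x)) ∧
    -- symmetry
    (∀ f g : X → ℝ, SobolevMMS.IsSobolevLoc m Ω f → SobolevMMS.IsSobolevLoc m Ω g →
      ∀ᵐ x ∂m.restrict Ω,
        SobolevMMS.gradDot m Ω f g x = SobolevMMS.gradDot m Ω g f x) := by
  have : SecondCountableTopology X := UniformSpace.secondCountable_of_separable X
  refine ⟨⟨fun f hf => hf.minGrad_spec, fun f hf => hf.locGrad_spec,
      fun f g hf hg => SobolevMMS.gradDot_spec hm hΩ hf hg⟩,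
    fun f g hf hg => ⟨SobolevMMS.gradDot_self hm hΩ hf, SobolevMMS.abs_gradDot_le hm hΩ hf hg⟩,
    fun f₁ f₂ g hf₁ hf₂ hg α β => ?_, fun f g hf hg φ ⟨K, hφ⟩ => ?_,
    fun f₁ f₂ g hf₁ hf₂ hb₁ hb₂ hg => ?_, fun f g hf hg => SobolevMMS.gradDot_symm hm hΩ hf hg⟩
  · have hl := hf₁.linear hf₂ α β
    have h := SobolevMMS.gradDot_linear_left hm hΩ hf₁ hf₂ hg α β
    refine ⟨hl, h, ?_⟩
    -- Symmetry transfers the rule from the first argument to the second.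
    filter_upwards [h, SobolevMMS.gradDot_symm hm hΩ hg hl, SobolevMMS.gradDot_symm hm hΩ hg hf₁,
      SobolevMMS.gradDot_symm hm hΩ hg hf₂] with x h1 h2 h3 h4
    rw [h2, h1, h3, h4]
  · have hl := hf.comp hφ
    have h := SobolevMMS.gradDot_comp_left hm hΩ hf hg hφ
    refine ⟨hl, h, ?_⟩
    filter_upwards [h, SobolevMMS.gradDot_symm hm hΩ hg hl, SobolevMMS.gradDot_symm hm hΩ hg hf]
      with x h1 h2 h3
    rw [h2, h1, h3]
  · have hl := hf₁.mul hf₂ hb₁ hb₂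
    have h := SobolevMMS.gradDot_mul_left hm hΩ hf₁ hf₂ hb₁ hb₂ hg
    refine ⟨hl, h, ?_⟩
    filter_upwards [h, SobolevMMS.gradDot_symm hm hΩ hg hl, SobolevMMS.gradDot_symm hm hΩ hg hf₁,
      SobolevMMS.gradDot_symm hm hΩ hg hf₂] with x h1 h2 h3 h4
    rw [h2, h1, h3, h4]
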